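/- A score sequence on the complete graph $K_n$ is the list $s_1\le\dots\le s_n$, in non-decreasing order, of the numbers of wins of the $n$ teams in some tournament (orientation of the edges of $K_n$). Let $S_n$ be the number of score sequences on $K_n$, and let $S_{n,1}$ be the number of those that are strong (irreducible), that is, for which $k=n$ is the only $k\in\{1,\dots,n\}$ with $\sum_{i=1}^k s_i=\binom k2$. Let $N_n$ be the number of subsets of $\{1,2,\dots,2n-1\}$ of size $n$ whose sum is a multiple of $n$, and put $\lambda=\sum_{k=1}^\infty \frac{N_k}{k4^k}$, which is a convergent series. Then, as $n\to\infty$, \[ \frac{S_{n,1}}{S_n}\to e^{-2\lambda}=0.516\ldots, \qquad\text{and}\qquad \frac{n^{5/2}S_{n,1}}{4^n}\to\frac{e^{-\lambda}}{2\sqrt\pi}=0.202\ldots . \] -/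

import Mathlib

open Filter Topology

namespace ScoreSeq

/-- A tournament on the complete graph with vertex set `V`: every edge `{v, w}` is oriented in
exactly one of its two directions, and there are no loops.
`T.Adj v w` means that `v` wins against `w`. -/
def IsTournament {V : Type*} (T : Digraph V) : Prop :=
  (∀ v, ¬ T.Adj v v) ∧ ∀ v w, v ≠ w → (T.Adj v w ↔ ¬ T.Adj w v)

/-- The number of wins of team `v`. -/
noncomputable def wins {V : Type*} (T : Digraph V) (v : V) : ℕ :=
  {w | T.Adj v w}.ncard

/-- `s` is a score sequence on `K_n`: it lists the numbers of wins of all the teams of some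
tournament on `n` teams in non-decreasing order. -/
def IsScoreSequence {n : ℕ} (s : Fin n → ℕ) : Prop :=
  Monotone s ∧
    ∃ T : Digraph (Fin n), IsTournament T ∧ ∃ σ : Equiv.Perm (Fin n), ∀ i, s i = wins T (σ i)

/-- There are finitely many score sequences on `K_n`, so that counting them with `Set.ncard`
is meaningful. -/
theorem finite_scoreSequences (n : ℕ) : {s : Fin n → ℕ | IsScoreSequence s}.Finite := by
  refine (Set.finite_Iic (fun _ : Fin n => n)).subset ?_
  rintro s ⟨-, T, -, σ, h⟩ i
  rw [h i]
  simpa [wins] using Set.ncard_le_card {w | T.Adj (σ i) w}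

/-- `S_n`: the number of score sequences on `K_n`. -/
noncomputable def S (n : ℕ) : ℕ :=
  {s : Fin n → ℕ | IsScoreSequence s}.ncard

/-- The number of irreducible subscores of `s`: the number of `k ∈ {1, …, n}` such that the sum of
the first `k` entries of `s` is equal to `k choose 2`. -/
def irreducibleSubscores {n : ℕ} (s : Fin n → ℕ) : ℕ :=
  ((Finset.Icc 1 n).filter fun k =>
    ∑ i ∈ Finset.univ.filter (fun i : Fin n => (i : ℕ) < k), s i = k.choose 2).card

/-- `S_{n,m}`: the number of score sequences on `K_n` with exactly `m` irreducible subscores.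
In particular, `S_{n,1}` is the number of strong (irreducible) score sequences. -/
noncomputable def Sm (n m : ℕ) : ℕ :=
  {s : Fin n → ℕ | IsScoreSequence s ∧ irreducibleSubscores s = m}.ncard

/-- `N_n`: the number of subsets of `{1, 2, …, 2n - 1}` of size `n` whose sum is a multiple of
`n` (for `n ≥ 1`). -/
def N (n : ℕ) : ℕ :=
  (((Finset.Icc 1 (2 * n - 1)).powersetCard n).filter fun A => n ∣ ∑ a ∈ A, a).card

/-- The term `N_k / (k 4^k)`, with index shifted so that `k = j + 1` runs over `1, 2, 3, …`. -/
noncomputable def lamTerm (j : ℕ) : ℝ :=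
  (N (j + 1) : ℝ) / (((j + 1 : ℕ) : ℝ) * 4 ^ (j + 1))

/-- `λ = ∑_{k ≥ 1} N_k / (k 4^k)`. -/
noncomputable def lam : ℝ := ∑' j, lamTerm j

end ScoreSeq

/-! By Landau's theorem (`isScoreSequence_of_choose_le` is the hard half, through Hall's theorem),
the excess of the partial sums of a score sequence over the binomials `k.choose 2` is an excursion:
a path in `ℕ` from 0 to 0 whose steps decrease by at most 1 from one to the next. At a zero of the
path this constraint is void, so excursions are free concatenations of irreducible ones. With
generating functions S and I of all and of strong score sequences, S = 1/(1 - I).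

Put B = x I' S, the logarithmic derivative x S'/S. Then S = exp(∑ B_n x^n / n) and 1 - I = exp(-∑
B_n x^n / n). The coefficient B_n counts excursions with a marked time before the first return;
cutting cyclic paths at their last minimum shows that it counts cyclic paths
(`ncard_cyclicPaths_eq_sum`). Up to shift these are quasi-periodic integer sequences, and choosing
another representative of each shift class turns them into the subsets counted by N_n
(`N_eq_ncard_cyclicPaths`). Hence B_n = N_n for n > 0.

A roots-of-unity filter writes 2n N_n as a signed sum of central binomials whose dominant term is
`n.centralBinom` (`two_mul_mul_N`), so n^(3/2) N_n / 4^n tends to 1/(2√π). The convolution n u_n = ∑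
p_k u_(n-k) characterises exponentials; when p decays like c n^(-3/2), it forces n^(5/2) u_n → c ∑
u_k = c exp(∑ p_k / k) (`IsExpCoeff.tendsto_exp`). With p = ±N_n / 4^n this gives both limits, with
factors e^λ for S and e^(-λ) for I, and ratio e^(-2λ). -/

/-! ### Convolutions of sequences with power-law decay -/

theorem tendsto_add_div_rpow (α : ℝ) (j : ℕ) :
    Tendsto (fun n : ℕ => (((n + j : ℕ) : ℝ) / n) ^ α) atTop (𝓝 1) := by
  have h1 : Tendsto (fun n : ℕ => ((n + j : ℕ) : ℝ) / n) atTop (𝓝 1) := by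
    have : Tendsto (fun n : ℕ => 1 + (j : ℝ) / n) atTop (𝓝 (1 + 0)) :=
      tendsto_const_nhds.add (tendsto_const_div_atTop_nhds_zero_nat (j : ℝ))
    rw [add_zero] at this
    refine this.congr' ?_
    filter_upwards [eventually_gt_atTop 0] with n hn
    have : (n : ℝ) ≠ 0 := by positivity
    push_cast
    field_simp
  have h2 := h1.rpow_const (p := α) (Or.inl one_ne_zero)
  simpa using h2

theorem tendsto_rpow_mul_comp_sub {f : ℕ → ℝ} {α c : ℝ}
    (hf : Tendsto (fun n : ℕ => (n : ℝ) ^ α * f n) atTop (𝓝 c)) (j : ℕ) :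
    Tendsto (fun n : ℕ => (n : ℝ) ^ α * f (n - j)) atTop (𝓝 c) := by
  rw [← tendsto_add_atTop_iff_nat j]
  have h := (tendsto_add_div_rpow α j).mul hf
  rw [one_mul] at h
  refine h.congr' ?_
  filter_upwards [eventually_gt_atTop 0] with n hn
  have hn' : (0 : ℝ) < n := by positivity
  rw [Real.div_rpow (by positivity) hn'.le, Nat.add_sub_cancel]
  have : (n : ℝ) ^ α ≠ 0 := by positivity
  field_simp

/-- One half of a convolution: the terms in which the factor `f` has the larger index. -/
theorem tendsto_half_convolution {f g : ℕ → ℝ} {α c : ℝ} (hα : 0 ≤ α)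
    (hf : Tendsto (fun n : ℕ => (n : ℝ) ^ α * f n) atTop (𝓝 c)) (hg : Summable fun n => |g n|)
    (P : ℕ → ℕ → Prop) [∀ n, DecidablePred (P n)] (hP : ∀ n j, P n j → 2 * j ≤ n)
    (hP' : ∀ j, ∀ᶠ n in atTop, P n j) :
    Tendsto (fun n : ℕ => (n : ℝ) ^ α * ∑ j ∈ (Finset.range (n + 1)).filter (P n), f (n - j) * g j)
      atTop (𝓝 (c * ∑' j, g j)) := by
  obtain ⟨C, hC⟩ := (hf.abs.bddAbove_range)
  have hC' : ∀ n : ℕ, (n : ℝ) ^ α * |f n| ≤ C := fun n => by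
    have : |(n : ℝ) ^ α * f n| ≤ C := hC ⟨n, rfl⟩
    rwa [abs_mul, abs_of_nonneg (by positivity)] at this
  have hC0 : 0 ≤ C := (mul_nonneg (by positivity) (abs_nonneg _)).trans (hC' 0)
  have key : Tendsto
      (fun n : ℕ => ∑' j, if P n j then (n : ℝ) ^ α * f (n - j) * g j else 0)
      atTop (𝓝 (∑' j, c * g j)) := by
    refine tendsto_tsum_of_dominated_convergence (bound := fun j => 2 ^ α * C * |g j|)
      (hg.mul_left _) (fun j => ?_) (Eventually.of_forall fun n j => ?_)
    · refine ((tendsto_rpow_mul_comp_sub hf j).mul_const (g j)).congr' ?_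
      filter_upwards [hP' j] with n hn
      rw [if_pos hn]
    · split_ifs with h
      · rw [Real.norm_eq_abs, abs_mul, abs_mul, abs_of_nonneg (by positivity : (0 : ℝ) ≤ (n : ℝ) ^ α)]
        refine mul_le_mul_of_nonneg_right ?_ (abs_nonneg _)
        have h2 := hP n j h
        -- The larger index is at least n / 2; this is the source of the factor `2 ^ α` in the
        -- dominating sequence.
        have h3 : (n : ℝ) ≤ 2 * ((n - j : ℕ) : ℝ) := by
          exact_mod_cast (by omega : n ≤ 2 * (n - j))
        calc (n : ℝ) ^ α * |f (n - j)| ≤ (2 * ((n - j : ℕ) : ℝ)) ^ α * |f (n - j)| := by gcongr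
          _ = 2 ^ α * (((n - j : ℕ) : ℝ) ^ α * |f (n - j)|) := by
            rw [Real.mul_rpow (by norm_num) (by positivity), mul_assoc]
          _ ≤ _ := by gcongr; exact hC' _
      · rw [norm_zero]; positivity
  rw [tsum_mul_left] at key
  refine key.congr fun n => ?_
  rw [tsum_eq_sum (s := (Finset.range (n + 1)).filter (P n)), Finset.mul_sum]
  · refine Finset.sum_congr rfl fun j hj => ?_
    rw [if_pos (Finset.mem_filter.1 hj).2, mul_assoc]
  · intro j hj
    rw [if_neg]
    intro h
    apply hj
    have := hP n j h
    simp only [Finset.mem_filter, Finset.mem_range]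
    exact ⟨by omega, h⟩

/-- With heavy tails, a convolution is large only when one index is close to n and the other
bounded; each of the two regimes contributes one term of the limit. -/
theorem tendsto_convolution {f g : ℕ → ℝ} {α c d : ℝ} (hα : 0 ≤ α)
    (hf : Tendsto (fun n : ℕ => (n : ℝ) ^ α * f n) atTop (𝓝 c)) (hfs : Summable fun n => |f n|)
    (hg : Tendsto (fun n : ℕ => (n : ℝ) ^ α * g n) atTop (𝓝 d)) (hgs : Summable fun n => |g n|) :
    Tendsto (fun n : ℕ => (n : ℝ) ^ α * ∑ ij ∈ Finset.HasAntidiagonal.antidiagonal n, f ij.1 * g ij.2)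
      atTop (𝓝 (c * ∑' j, g j + d * ∑' j, f j)) := by
  -- One inequality is weak and the other strict, so that the diagonal term is counted once.
  have h1 := tendsto_half_convolution hα hf hgs (fun n j => 2 * j ≤ n) (fun _ _ h => h)
    (fun j => eventually_ge_atTop _)
  have h2 := tendsto_half_convolution hα hg hfs (fun n j => 2 * j < n) (fun _ _ h => h.le)
    (fun j => eventually_gt_atTop _)
  refine (h1.add h2).congr fun n => ?_
  rw [← mul_add, Finset.Nat.sum_antidiagonal_eq_sum_range_succ (fun i j => f i * g j),
    ← Finset.sum_filter_add_sum_filter_not (Finset.range (n + 1)) (fun i => 2 * i < n)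
      (fun i => f i * g (n - i)), add_comm]
  congr 2
  · exact Finset.sum_congr rfl fun i _ => mul_comm _ _
  · refine Finset.sum_nbij' (fun j => n - j) (fun j => n - j) ?_ ?_ ?_ ?_ ?_
    · simp only [Finset.mem_filter, Finset.mem_range]; intros; omega
    · simp only [Finset.mem_filter, Finset.mem_range]; intros; omega
    · simp only [Finset.mem_filter, Finset.mem_range]; intros; omega
    · simp only [Finset.mem_filter, Finset.mem_range]; intros; omega
    · simp only [Finset.mem_filter, Finset.mem_range]
      rintro j ⟨h1, h2⟩
      rw [Nat.sub_sub_self (by omega)]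

/-! ### Growth of the coefficients of an exponential -/

/-- `u` is the sequence of coefficients of `exp (∑ p n x ^ n / n)`. -/
structure IsExpCoeff (p u : ℕ → ℝ) : Prop where
  zero : p 0 = 0
  one : u 0 = 1
  recurrence : ∀ n : ℕ, (n : ℝ) * u n = ∑ ij ∈ Finset.HasAntidiagonal.antidiagonal n, p ij.1 * u ij.2

theorem summable_abs_of_tendsto_rpow_mul {f : ℕ → ℝ} {α c : ℝ} (hα : 1 < α)
    (hf : Tendsto (fun n : ℕ => (n : ℝ) ^ α * f n) atTop (𝓝 c)) : Summable fun n => |f n| := by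
  obtain ⟨C, hC⟩ := (hf.abs.bddAbove_range)
  have hs : Summable fun n : ℕ => C * (1 / (n : ℝ) ^ α) :=
    (Real.summable_one_div_nat_rpow.2 hα).mul_left C
  rw [← summable_nat_add_iff 1] at hs ⊢
  refine hs.of_nonneg_of_le (fun _ => abs_nonneg _) fun n => ?_
  have := hC ⟨n + 1, rfl⟩
  have hp : (0 : ℝ) < ((n + 1 : ℕ) : ℝ) ^ α := by positivity
  simp only [abs_mul, abs_of_pos hp] at this
  rw [mul_one_div, le_div_iff₀ hp]
  linarith

theorem IsExpCoeff.nonneg {p u : ℕ → ℝ} (h : IsExpCoeff p u) (hp : ∀ n, 0 ≤ p n) (n : ℕ) :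
    0 ≤ u n := by
  induction n using Nat.strong_induction_on with
  | _ n ih =>
    rcases Nat.eq_zero_or_pos n with rfl | hn
    · rw [h.one]; exact zero_le_one
    · have : 0 ≤ (n : ℝ) * u n := by
        rw [h.recurrence]
        refine Finset.sum_nonneg fun ij hij => ?_
        rw [Finset.HasAntidiagonal.mem_antidiagonal] at hij
        rcases Nat.eq_zero_or_pos ij.1 with h0 | h0
        · rw [h0, h.zero, zero_mul]
        · exact mul_nonneg (hp _) (ih _ (by omega))
      exact nonneg_of_mul_nonneg_right this (by positivity)

/-- The weight w = 1/(n+1)^2 is an eventual supersolution of the recurrence: its convolution with p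
is O(n^(-3/2)), whereas n w n is of order 1/n. Strong induction then carries u ≤ K w past any
threshold. This a priori bound is what the sharp asymptotics need. -/
theorem IsExpCoeff.exists_le {p u : ℕ → ℝ} {c : ℝ} (h : IsExpCoeff p u) (hp : ∀ n, 0 ≤ p n)
    (hc : Tendsto (fun n : ℕ => (n : ℝ) ^ (3 / 2 : ℝ) * p n) atTop (𝓝 c)) :
    ∃ K, ∀ n, u n ≤ K * (1 / ((n : ℝ) + 1) ^ 2) := by
  set w : ℕ → ℝ := fun n => 1 / ((n : ℝ) + 1) ^ 2 with hw
  have hw0 : ∀ n, 0 < w n := fun n => by positivity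
  have hw1 : Tendsto (fun n : ℕ => (n : ℝ) ^ (3 / 2 : ℝ) * w n) atTop (𝓝 0) := by
    have h0 : Tendsto (fun n : ℕ => (n : ℝ) ^ (-(1 / 2) : ℝ)) atTop (𝓝 0) :=
      (tendsto_rpow_neg_atTop (by norm_num)).comp tendsto_natCast_atTop_atTop
    refine squeeze_zero' (Eventually.of_forall fun n => by positivity) ?_ h0
    filter_upwards [eventually_gt_atTop 0] with n hn
    have hn' : (0 : ℝ) < n := by positivity
    have : (n : ℝ) ^ (-(1 / 2) : ℝ) = (n : ℝ) ^ (3 / 2 : ℝ) * (1 / (n : ℝ) ^ 2) := by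
      rw [show (-(1 / 2) : ℝ) = 3 / 2 - 2 by norm_num, Real.rpow_sub hn', Real.rpow_two]
      ring
    rw [this]
    simp only [hw]
    gcongr
    linarith
  have hps := summable_abs_of_tendsto_rpow_mul (by norm_num) hc
  have hws : Summable fun n => |w n| := summable_abs_of_tendsto_rpow_mul (by norm_num) hw1
  have hconv := tendsto_convolution (by norm_num) hc hps hw1 hws
  obtain ⟨C, hC⟩ := hconv.bddAbove_range
  -- the convolution of `p` with `w` is eventually at most `n * w n`
  have hev : ∀ᶠ n : ℕ in atTop, ∑ ij ∈ Finset.HasAntidiagonal.antidiagonal n, p ij.1 * w ij.2 ≤ n * w n := by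
    have ht : Tendsto (fun n : ℕ => (n : ℝ) ^ (1 / 2 : ℝ)) atTop atTop :=
      (tendsto_rpow_atTop (by norm_num)).comp tendsto_natCast_atTop_atTop
    -- The 4 compensates n^2 w n ≥ 1/4, valid from n = 1 on.
    filter_upwards [ht.eventually_ge_atTop (4 * C), eventually_gt_atTop 0] with n h1 hn
    have hn1 : (1 : ℝ) ≤ n := by exact_mod_cast hn
    have hn' : (0 : ℝ) < n := by positivity
    have h2 : (n : ℝ) ^ (3 / 2 : ℝ) * ∑ ij ∈ Finset.HasAntidiagonal.antidiagonal n, p ij.1 * w ij.2 ≤ C :=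
      hC ⟨n, rfl⟩
    have h3 : 0 < (n : ℝ) ^ (3 / 2 : ℝ) := by positivity
    refine le_of_mul_le_mul_left (h2.trans ?_) h3
    have h4 : (n : ℝ) ^ (3 / 2 : ℝ) = n * (n : ℝ) ^ (1 / 2 : ℝ) := by
      rw [show (3 / 2 : ℝ) = 1 + 1 / 2 by norm_num, Real.rpow_add hn', Real.rpow_one]
    have h5 : 1 / 4 ≤ (n : ℝ) ^ 2 * w n := by
      simp only [hw]
      rw [mul_one_div, div_le_div_iff₀ (by norm_num) (by positivity)]
      nlinarith
    rw [h4]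
    calc C ≤ (n : ℝ) ^ (1 / 2 : ℝ) * (1 / 4) := by linarith
      _ ≤ (n : ℝ) ^ (1 / 2 : ℝ) * ((n : ℝ) ^ 2 * w n) := by gcongr
      _ = _ := by ring
  obtain ⟨m, hm⟩ := eventually_atTop.1 hev
  -- A sum of nonnegative ratios bounds each of them, which settles all n ≤ m at once.
  set K := ∑ i ∈ Finset.range (m + 1), u i / w i with hK
  have hu := h.nonneg hp
  have hK0 : 0 ≤ K := Finset.sum_nonneg fun i _ => div_nonneg (hu i) (hw0 i).le
  refine ⟨K, fun n => ?_⟩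
  change u n ≤ K * w n
  induction n using Nat.strong_induction_on with
  | _ n ih =>
    by_cases hnm : n < m + 1
    · rw [← div_le_iff₀ (hw0 n)]
      exact Finset.single_le_sum (f := fun i => u i / w i)
        (fun i _ => div_nonneg (hu i) (hw0 i).le) (Finset.mem_range.2 hnm)
    · have hn' : (0 : ℝ) < n := by
        have : 0 < n := by omega
        positivity
      refine le_of_mul_le_mul_left ?_ hn'
      rw [h.recurrence]
      calc ∑ ij ∈ Finset.HasAntidiagonal.antidiagonal n, p ij.1 * u ij.2
          ≤ ∑ ij ∈ Finset.HasAntidiagonal.antidiagonal n, K * (p ij.1 * w ij.2) := by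
            refine Finset.sum_le_sum fun ij hij => ?_
            rw [Finset.HasAntidiagonal.mem_antidiagonal] at hij
            rcases Nat.eq_zero_or_pos ij.1 with h0 | h0
            · rw [h0, h.zero]; simp
            · have := mul_le_mul_of_nonneg_left (ih ij.2 (by omega)) (hp ij.1)
              linarith
        _ = K * ∑ ij ∈ Finset.HasAntidiagonal.antidiagonal n, p ij.1 * w ij.2 := by rw [Finset.mul_sum]
        _ ≤ K * (n * w n) := mul_le_mul_of_nonneg_left (hm n (by omega)) hK0
        _ = _ := by ring

theorem tendsto_rpow_mul_of_abs_le {u : ℕ → ℝ} {K : ℝ}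
    (hu : ∀ n, |u n| ≤ K * (1 / ((n : ℝ) + 1) ^ 2)) :
    Tendsto (fun n : ℕ => (n : ℝ) ^ (3 / 2 : ℝ) * u n) atTop (𝓝 0) := by
  have h0 : Tendsto (fun n : ℕ => K * (n : ℝ) ^ (-(1 / 2) : ℝ)) atTop (𝓝 (K * 0)) :=
    ((tendsto_rpow_neg_atTop (by norm_num)).comp tendsto_natCast_atTop_atTop).const_mul K
  rw [mul_zero] at h0
  have hK : 0 ≤ K := by simpa using (abs_nonneg _).trans (hu 0)
  refine squeeze_zero_norm' ?_ h0
  filter_upwards [eventually_gt_atTop 0] with n hn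
  have hn' : (0 : ℝ) < n := by positivity
  have : (n : ℝ) ^ (-(1 / 2) : ℝ) = (n : ℝ) ^ (3 / 2 : ℝ) * (1 / (n : ℝ) ^ 2) := by
    rw [show (-(1 / 2) : ℝ) = 3 / 2 - 2 by norm_num, Real.rpow_sub hn', Real.rpow_two]
    ring
  rw [this, norm_mul, Real.norm_eq_abs, Real.norm_eq_abs, abs_of_nonneg (by positivity)]
  calc (n : ℝ) ^ (3 / 2 : ℝ) * |u n| ≤ (n : ℝ) ^ (3 / 2 : ℝ) * (K * (1 / ((n : ℝ) + 1) ^ 2)) := by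
        gcongr; exact hu n
    _ ≤ (n : ℝ) ^ (3 / 2 : ℝ) * (K * (1 / (n : ℝ) ^ 2)) := by gcongr; linarith
    _ = _ := by ring

/-- Since n^(3/2) u n → 0, only the regime where p carries the large index survives in the
convolution for n u n. -/
theorem IsExpCoeff.tendsto {p u : ℕ → ℝ} {c K : ℝ} (h : IsExpCoeff p u)
    (hc : Tendsto (fun n : ℕ => (n : ℝ) ^ (3 / 2 : ℝ) * p n) atTop (𝓝 c))
    (hu : ∀ n, |u n| ≤ K * (1 / ((n : ℝ) + 1) ^ 2)) :
    Tendsto (fun n : ℕ => (n : ℝ) ^ (5 / 2 : ℝ) * u n) atTop (𝓝 (c * ∑' n, u n)) := by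
  have h1 := tendsto_rpow_mul_of_abs_le hu
  have h2 := tendsto_convolution (by norm_num) hc
    (summable_abs_of_tendsto_rpow_mul (by norm_num) hc) h1
    (summable_abs_of_tendsto_rpow_mul (by norm_num) h1)
  rw [zero_mul, add_zero] at h2
  refine h2.congr' ?_
  filter_upwards [eventually_gt_atTop 0] with n hn
  have hn' : (0 : ℝ) < n := by positivity
  rw [← h.recurrence, show (5 / 2 : ℝ) = 3 / 2 + 1 by norm_num, Real.rpow_add hn', Real.rpow_one, mul_assoc]

/-! ### The sum of an exponential series at the boundary point 1 -/

theorem summable_abs_of_summable_abs_natCast_mul {v : ℕ → ℝ}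
    (hv : Summable fun n : ℕ => |(n : ℝ) * v n|) : Summable fun n => |v n| := by
  rw [← summable_nat_add_iff 1] at hv ⊢
  refine hv.of_nonneg_of_le (fun _ => abs_nonneg _) fun n => ?_
  rw [abs_mul]
  refine le_mul_of_one_le_left (abs_nonneg _) ?_
  rw [Nat.abs_cast]
  exact_mod_cast Nat.le_add_left 1 n

theorem hasDerivAt_tsum_mul_pow {v : ℕ → ℝ} (hv : Summable fun n : ℕ => |(n : ℝ) * v n|) {x : ℝ}
    (hx : x ∈ Set.Ioo (-1 : ℝ) 1) :
    HasDerivAt (fun z => ∑' n, v n * z ^ n)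
      (∑' n : ℕ, ((n + 1 : ℕ) : ℝ) * v (n + 1) * x ^ n) x := by
  have habs : ∀ y ∈ Set.Ioo (-1 : ℝ) 1, |y| ≤ 1 := fun y hy => (abs_lt.2 hy).le
  have hbd : ∀ (n : ℕ) (y : ℝ), y ∈ Set.Ioo (-1 : ℝ) 1 →
      ‖v n * (n * y ^ (n - 1))‖ ≤ |(n : ℝ) * v n| := fun n y hy => by
    rw [Real.norm_eq_abs, show v n * (n * y ^ (n - 1)) = n * v n * y ^ (n - 1) by ring, abs_mul,
      abs_pow]
    exact mul_le_of_le_one_right (abs_nonneg _) (pow_le_one₀ (abs_nonneg _) (habs y hy))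
  have h := hasDerivAt_tsum_of_isPreconnected (g := fun n z => v n * z ^ n)
    (g' := fun n z => v n * (n * z ^ (n - 1))) hv isOpen_Ioo isPreconnected_Ioo
    (fun n y _ => (hasDerivAt_pow n y).const_mul (v n)) hbd hx
    ((summable_abs_of_summable_abs_natCast_mul hv).of_norm_bounded fun n => by
      rw [Real.norm_eq_abs, abs_mul, abs_pow]
      exact mul_le_of_le_one_right (abs_nonneg _) (pow_le_one₀ (abs_nonneg _) (habs x hx))) hx
  have hs : Summable fun n : ℕ => v n * (n * x ^ (n - 1)) :=
    hv.of_norm_bounded fun n => hbd n x hx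
  rw [hs.tsum_eq_zero_add] at h
  refine h.congr_deriv ?_
  simp only [Nat.cast_zero, zero_mul, mul_zero, zero_add, Nat.add_sub_cancel]
  exact tsum_congr fun n => by ring

theorem continuousOn_tsum_mul_pow {v : ℕ → ℝ} (hv : Summable fun n : ℕ => |v n|) :
    ContinuousOn (fun z : ℝ => ∑' n, v n * z ^ n) (Set.Icc 0 1) := by
  refine continuousOn_tsum (fun n => by fun_prop) hv fun n y hy => ?_
  rw [Real.norm_eq_abs, abs_mul, abs_pow, abs_of_nonneg hy.1]
  exact mul_le_of_le_one_right (abs_nonneg _) (pow_le_one₀ hy.1 hy.2)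

/-- The recurrence is the differential equation U' = A' U on [0, 1), so U exp(-A) is constant there.
Absolute convergence makes U and A continuous up to 1, where the identity is read off. -/
theorem IsExpCoeff.tsum_eq_exp {p u : ℕ → ℝ} (h : IsExpCoeff p u) (hp : Summable fun n => |p n|)
    (hu : Summable fun n : ℕ => |(n : ℝ) * u n|) : ∑' n, u n = Real.exp (∑' n, p n / n) := by
  set a : ℕ → ℝ := fun n => p n / n with ha_def
  have hna : ∀ n : ℕ, (n : ℝ) * a n = p n := fun n => by
    rcases Nat.eq_zero_or_pos n with rfl | hn
    · simp [h.zero]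
    · have : (n : ℝ) ≠ 0 := by positivity
      simp only [ha_def]
      field_simp
  have ha : Summable fun n : ℕ => |(n : ℝ) * a n| := by simpa only [hna] using hp
  have hu' := summable_abs_of_summable_abs_natCast_mul hu
  have ha' := summable_abs_of_summable_abs_natCast_mul ha
  set U : ℝ → ℝ := fun z => ∑' n, u n * z ^ n with hU
  set A : ℝ → ℝ := fun z => ∑' n, a n * z ^ n with hA
  have hrec : ∀ n : ℕ, ((n + 1 : ℕ) : ℝ) * u (n + 1) =
      ∑ ij ∈ Finset.HasAntidiagonal.antidiagonal n, p (ij.1 + 1) * u ij.2 := fun n => by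
    rw [h.recurrence, Finset.Nat.sum_antidiagonal_succ, h.zero, zero_mul, zero_add]
  have hode : ∀ x ∈ Set.Ico (0 : ℝ) 1,
      ∑' n : ℕ, ((n + 1 : ℕ) : ℝ) * u (n + 1) * x ^ n =
        (∑' n : ℕ, ((n + 1 : ℕ) : ℝ) * a (n + 1) * x ^ n) * U x := fun x hx => by
    simp only [hna]
    have hxp : ∀ n, |x ^ n| ≤ 1 := fun n => by
      rw [abs_pow, abs_of_nonneg hx.1]; exact pow_le_one₀ hx.1 hx.2.le
    rw [hU, tsum_mul_tsum_eq_tsum_sum_antidiagonal_of_summable_norm]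
    · refine tsum_congr fun n => ?_
      rw [hrec, Finset.sum_mul]
      refine Finset.sum_congr rfl fun ij hij => ?_
      rw [← Finset.HasAntidiagonal.mem_antidiagonal.1 hij, pow_add]
      ring
    · refine ((summable_nat_add_iff 1).2 hp).of_nonneg_of_le (fun _ => norm_nonneg _) fun n => ?_
      rw [Real.norm_eq_abs, abs_mul]
      exact mul_le_of_le_one_right (abs_nonneg _) (hxp n)
    · refine hu'.of_nonneg_of_le (fun _ => norm_nonneg _) fun n => ?_
      rw [Real.norm_eq_abs, abs_mul]
      exact mul_le_of_le_one_right (abs_nonneg _) (hxp n)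
  have hconst := constant_of_has_deriv_right_zero (f := fun z => U z * Real.exp (-A z))
    (a := 0) (b := 1)
    ((continuousOn_tsum_mul_pow hu').mul
      (Real.continuous_exp.comp_continuousOn (continuousOn_tsum_mul_pow ha').neg)) (fun x hx => by
      have hx' : x ∈ Set.Ioo (-1 : ℝ) 1 := ⟨by linarith [hx.1], hx.2⟩
      have h1 := hasDerivAt_tsum_mul_pow hu hx'
      have h2 := hasDerivAt_tsum_mul_pow ha hx'
      have h3 := h1.mul h2.neg.exp
      refine (h3.congr_deriv ?_).hasDerivWithinAt
      rw [hode x hx]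
      simp only [hU]
      ring)
  have h10 := hconst 1 ⟨zero_le_one, le_rfl⟩
  have hU0 : U 0 = 1 := by
    simp only [hU]
    rw [tsum_eq_single 0 fun n hn => by simp [hn]]
    simp [h.one]
  have hA0 : A 0 = 0 := by
    simp only [hA]
    rw [tsum_eq_single 0 fun n hn => by simp [hn]]
    simp [ha_def]
  simp only [hU0, hA0, neg_zero, Real.exp_zero, mul_one] at h10
  rw [Real.exp_neg, mul_inv_eq_one₀ (Real.exp_ne_zero _)] at h10
  simpa [hU, hA] using h10

theorem IsExpCoeff.summable_natCast_mul {p u : ℕ → ℝ} {c K : ℝ} (h : IsExpCoeff p u)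
    (hc : Tendsto (fun n : ℕ => (n : ℝ) ^ (3 / 2 : ℝ) * p n) atTop (𝓝 c))
    (hu : ∀ n, |u n| ≤ K * (1 / ((n : ℝ) + 1) ^ 2)) :
    Summable fun n : ℕ => |(n : ℝ) * u n| := by
  refine summable_abs_of_tendsto_rpow_mul (α := 3 / 2) (by norm_num)
    ((h.tendsto hc hu).congr' ?_)
  filter_upwards [eventually_gt_atTop 0] with n hn
  have hn' : (0 : ℝ) < n := by positivity
  rw [show (5 / 2 : ℝ) = 3 / 2 + 1 by norm_num, Real.rpow_add hn', Real.rpow_one, mul_assoc]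

theorem IsExpCoeff.tendsto_exp {p u : ℕ → ℝ} {c K : ℝ} (h : IsExpCoeff p u)
    (hc : Tendsto (fun n : ℕ => (n : ℝ) ^ (3 / 2 : ℝ) * p n) atTop (𝓝 c))
    (hu : ∀ n, |u n| ≤ K * (1 / ((n : ℝ) + 1) ^ 2)) :
    Tendsto (fun n : ℕ => (n : ℝ) ^ (5 / 2 : ℝ) * u n) atTop
      (𝓝 (c * Real.exp (∑' n, p n / n))) := by
  rw [← h.tsum_eq_exp (summable_abs_of_tendsto_rpow_mul (by norm_num) hc)
    (h.summable_natCast_mul hc hu)]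
  exact h.tendsto hc hu

/-! ### Generating functions of sequences of blocks -/

open PowerSeries in
theorem isExpCoeff_of_X_mul_derivative {P U : PowerSeries ℝ} (hP : coeff 0 P = 0)
    (hU : coeff 0 U = 1) (h : X * derivative ℝ U = P * U) :
    IsExpCoeff (fun n => coeff n P) (fun n => coeff n U) where
  zero := hP
  one := hU
  recurrence n := by
    rw [← coeff_mul, ← h]
    cases n with
    | zero => simp
    | succ n => rw [coeff_succ_X_mul, coeff_derivative]; push_cast; ring

open PowerSeries in
/-- If `S` counts sequences of irreducible blocks counted by `I`, and `B` counts such sequences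
with a marked position in the first block, then `S` and `1 - I` are the exponentials of
`± ∑ B n x ^ n / n`. -/
theorem isExpCoeff_of_blocks {S I B : PowerSeries ℝ} (hI0 : coeff 0 I = 0)
    (hS0 : coeff 0 S = 1) (hS : S = 1 + I * S) (hB : B = X * derivative ℝ I * S) :
    IsExpCoeff (fun n => coeff n B) (fun n => coeff n S) ∧
      IsExpCoeff (fun n => coeff n (-B)) (fun n => coeff n (1 - I)) := by
  have hB0 : coeff 0 B = 0 := by rw [hB, mul_assoc, coeff_zero_X_mul]
  have hQ : (1 - I) * S = 1 := by linear_combination hS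
  have hd : derivative ℝ S = derivative ℝ I * S + I * derivative ℝ S := by
    have := congrArg (derivative ℝ) hS
    rw [map_add, Derivation.leibniz, Derivation.map_one_eq_zero] at this
    simp only [smul_eq_mul] at this
    linear_combination this
  refine ⟨isExpCoeff_of_X_mul_derivative hB0 hS0 ?_, isExpCoeff_of_X_mul_derivative ?_ ?_ ?_⟩
  · linear_combination (-X * derivative ℝ S) * hQ + X * S * hd - S * hB
  · rw [map_neg, hB0, neg_zero]
  · rw [map_sub, hI0, sub_zero, coeff_zero_one]
  · rw [map_sub, Derivation.map_one_eq_zero]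
    linear_combination (X * derivative ℝ I) * hQ + (1 - I) * hB

/-- Rescaling by `4 ^ n` puts the singularity at 1. The exponential asymptotics are then applied to
S, and to 1 - I with the sign of p reversed. -/
theorem tendsto_of_blocks {S I B : ℕ → ℕ} {c : ℝ} (hI0 : I 0 = 0) (hS0 : S 0 = 1)
    (hS : ∀ n, 0 < n → S n = ∑ ij ∈ Finset.HasAntidiagonal.antidiagonal n, I ij.1 * S ij.2)
    (hB : ∀ n, B n = ∑ ij ∈ Finset.HasAntidiagonal.antidiagonal n, ij.1 * I ij.1 * S ij.2)
    (hc : Tendsto (fun n : ℕ => (n : ℝ) ^ (3 / 2 : ℝ) * (B n / 4 ^ n)) atTop (𝓝 c)) :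
    Tendsto (fun n : ℕ => (n : ℝ) ^ (5 / 2 : ℝ) * (S n / 4 ^ n)) atTop
        (𝓝 (c * Real.exp (∑' n : ℕ, (B n : ℝ) / 4 ^ n / n))) ∧
      Tendsto (fun n : ℕ => (n : ℝ) ^ (5 / 2 : ℝ) * (I n / 4 ^ n)) atTop
        (𝓝 (c * Real.exp (-∑' n : ℕ, (B n : ℝ) / 4 ^ n / n))) := by
  set s : ℕ → ℝ := fun n => S n / 4 ^ n with hs
  set t : ℕ → ℝ := fun n => I n / 4 ^ n with ht
  set p : ℕ → ℝ := fun n => B n / 4 ^ n with hp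
  have hscale : ∀ {n : ℕ} {ij : ℕ × ℕ}, ij ∈ Finset.HasAntidiagonal.antidiagonal n → ∀ x y : ℝ,
      x * y / 4 ^ n = x / 4 ^ ij.1 * (y / 4 ^ ij.2) := fun hij x y => by
    rw [← Finset.HasAntidiagonal.mem_antidiagonal.1 hij, pow_add]
    field_simp
  obtain ⟨h1, h2⟩ := isExpCoeff_of_blocks (S := .mk s) (I := .mk t) (B := .mk p)
    (by simp [ht, hI0]) (by simp [hs, hS0])
    (by
      ext n
      rw [map_add, PowerSeries.coeff_mul, PowerSeries.coeff_one]
      simp only [PowerSeries.coeff_mk]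
      rcases Nat.eq_zero_or_pos n with rfl | hn
      · simp [hs, ht, hI0, hS0]
      · rw [if_neg hn.ne', zero_add]
        simp only [hs, ht, hS n hn, Nat.cast_sum, Nat.cast_mul, Finset.sum_div]
        exact Finset.sum_congr rfl fun ij hij => hscale hij _ _)
    (by
      ext n
      rw [PowerSeries.coeff_mul]
      simp only [PowerSeries.coeff_mk]
      simp only [hp, hB n, Nat.cast_sum, Nat.cast_mul, Finset.sum_div]
      refine Finset.sum_congr rfl fun ij hij => ?_
      rw [hscale hij]
      congr 1
      rcases ij.1 with - | i
      · simp
      · rw [PowerSeries.coeff_succ_X_mul, PowerSeries.coeff_derivative, PowerSeries.coeff_mk]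
        simp only [ht]
        push_cast
        ring)
  simp only [PowerSeries.coeff_mk, map_neg, map_sub, PowerSeries.coeff_one] at h1 h2
  have hp0 : ∀ n, 0 ≤ p n := fun n => by positivity
  have hs0 := h1.nonneg hp0
  obtain ⟨K, hK⟩ := h1.exists_le hp0 hc
  -- For 1 - I the exponent has negative coefficients, so `IsExpCoeff.exists_le` does not apply; the
  -- bound is inherited from S instead.
  have hle : ∀ n, t n ≤ s n := fun n => by
    rcases Nat.eq_zero_or_pos n with rfl | hn
    · simp [ht, hI0, hs0]
    · simp only [ht, hs]
      gcongr
      rw [hS n hn]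
      refine le_trans ?_ (Finset.single_le_sum (f := fun ij : ℕ × ℕ => I ij.1 * S ij.2)
        (fun _ _ => Nat.zero_le _) (a := (n, 0))
        (Finset.HasAntidiagonal.mem_antidiagonal.2 (add_zero n)))
      simp [hS0]
  have hq : ∀ n, |(if n = 0 then 1 else 0) - t n| ≤ s n := fun n => by
    split_ifs with hn
    · subst hn
      simp [ht, hs, hI0, hS0]
    · rw [zero_sub, abs_neg, abs_of_nonneg (by positivity)]
      exact hle n
  refine ⟨h1.tendsto_exp hc fun n => by rw [abs_of_nonneg (hs0 n)]; exact hK n, ?_⟩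
  have hc' : Tendsto (fun n : ℕ => (n : ℝ) ^ (3 / 2 : ℝ) * -p n) atTop (𝓝 (-c)) := by
    simpa only [mul_neg] using hc.neg
  have h3 := (h2.tendsto_exp hc' fun n => (hq n).trans (hK n)).neg
  simp only [neg_div, tsum_neg, neg_mul, neg_neg] at h3
  refine h3.congr' ?_
  filter_upwards [eventually_gt_atTop 0] with n hn
  rw [if_neg hn.ne', zero_sub, mul_neg, neg_neg]

/-! ### Excursions, first returns and cyclic paths -/

namespace ScoreSeq

/-- Paths from `0` to `0` of length `n` in `ℕ`, extended by zero, whose steps decrease by at most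
`1` from one to the next: `P k` is the excess of the sum of the first `k` entries of a score
sequence over `k choose 2`. -/
def excursions (n : ℕ) : Set (ℕ → ℕ) :=
  {P | P 0 = 0 ∧ (∀ i, n ≤ i → P i = 0) ∧ ∀ i, 2 * P (i + 1) ≤ P i + P (i + 2) + 1}

/-- The excursions of positive length `n` that do not return to `0` before time `n`. -/
def irreducibles (n : ℕ) : Set (ℕ → ℕ) :=
  {P | P ∈ excursions n ∧ 0 < n ∧ ∀ i, 0 < i → i < n → P i ≠ 0}

/-- Periodic paths in `ℤ` that vanish at `0`, whose steps decrease by at most `1`. -/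
def cyclicPaths (n : ℕ) : Set (ℤ → ℤ) :=
  {Q | Q 0 = 0 ∧ (∀ i, Q (i + n) = Q i) ∧ ∀ i, 2 * Q (i + 1) ≤ Q i + Q (i + 2) + 1}

/-- The first positive time at which `P` vanishes. -/
noncomputable def firstReturn (P : ℕ → ℕ) : ℕ := sInf {k | 0 < k ∧ P k = 0}

/-- Steps drop by at most 1 each time and the last step, ending at 0, is not positive, so earlier
steps cannot be large. This yields finiteness. -/
theorem excursions_step_le {n : ℕ} {P : ℕ → ℕ} (hP : P ∈ excursions n) (i : ℕ) :
    P (i + 1) ≤ P i + (n - i) := by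
  obtain ⟨h0, h1, h2⟩ := hP
  rcases le_or_gt n i with h | h
  · rw [h1 (i + 1) (by omega)]; omega
  · obtain ⟨j, rfl⟩ := Nat.exists_eq_add_of_lt h
    induction j generalizing i with
    | zero =>
      rw [h1 (i + 1) (by omega)]; omega
    | succ j ih =>
      have h3 := ih (i + 1) (by convert h1 using 3; omega) (by omega)
      have h4 : 2 * P (i + 1) ≤ P i + P (i + 1 + 1) + 1 := h2 i
      omega

theorem finite_excursions (n : ℕ) : (excursions n).Finite := by
  refine Set.Finite.of_injOn (f := fun P (i : Fin n) => P i)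
    (t := Set.Iic fun _ => n * n) ?_ ?_ (Set.finite_Iic _)
  · intro P hP i
    have key : ∀ j, P j ≤ j * n := fun j => by
      induction j with
      | zero => simp [hP.1]
      | succ j ih =>
        have := excursions_step_le hP j
        rw [Nat.succ_mul]
        omega
    exact (key i).trans (Nat.mul_le_mul_right _ i.2.le)
  · intro P hP P' hP' h
    ext i
    rcases lt_or_ge i n with hi | hi
    · exact congrFun h ⟨i, hi⟩
    · rw [hP.2.1 i hi, hP'.2.1 i hi]

theorem firstReturn_spec {n : ℕ} {P : ℕ → ℕ} (hn : 0 < n) (hP : P ∈ excursions n) :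
    0 < firstReturn P ∧ P (firstReturn P) = 0 :=
  Nat.sInf_mem (s := {k | 0 < k ∧ P k = 0}) ⟨n, hn, hP.2.1 n le_rfl⟩

theorem firstReturn_le {P : ℕ → ℕ} {k : ℕ} (hk : 0 < k) (h : P k = 0) : firstReturn P ≤ k :=
  Nat.sInf_le ⟨hk, h⟩

theorem ne_zero_of_lt_firstReturn {P : ℕ → ℕ} {k : ℕ} (hk : 0 < k) (h : k < firstReturn P) :
    P k ≠ 0 := fun h0 => absurd (firstReturn_le hk h0) (by omega)

theorem firstReturn_eq {n k : ℕ} {P : ℕ → ℕ} (hP : P ∈ excursions n) (hk : 0 < k)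
    (hkn : k ≤ n) (h0 : P k = 0) (h : ∀ i, 0 < i → i < k → P i ≠ 0) : firstReturn P = k := by
  obtain ⟨h1, h2⟩ := firstReturn_spec (hk.trans_le hkn) hP
  exact (firstReturn_le hk h0).antisymm (not_lt.1 fun hlt => h _ h1 hlt h2)

/-- Cut at the first return: the step condition centred at a zero holds trivially, so the two pieces
are independent and glue back freely. -/
theorem ncard_firstReturn_eq {n k : ℕ} (hn : 0 < n) (hk : k ≤ n) :
    {P | P ∈ excursions n ∧ firstReturn P = k}.ncard =
      (irreducibles k).ncard * (excursions (n - k)).ncard := by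
  rcases Nat.eq_zero_or_pos k with rfl | hk0
  · have h1 : {P | P ∈ excursions n ∧ firstReturn P = 0} = ∅ := by
      ext P
      simp only [Set.mem_ofPred_eq, Set.mem_empty_iff_false, iff_false, not_and]
      exact fun hP h => (firstReturn_spec hn hP).1.ne' h
    have h2 : irreducibles 0 = ∅ := by
      ext P
      simp [irreducibles]
    rw [h1, h2, Set.ncard_empty, zero_mul]
  rw [← Set.ncard_prod]
  symm
  refine Set.ncard_congr (fun p _ i => if i < k then p.1 i else p.2 (i - k)) ?_ ?_ ?_
  · rintro ⟨P, R⟩ ⟨⟨⟨h0, h1, h2⟩, -, h3⟩, ⟨g0, g1, g2⟩⟩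
    simp only at h0 h1 h2 h3 g0 g1 g2
    have hmem : (fun i => if i < k then P i else R (i - k)) ∈ excursions n := by
      refine ⟨by simp [hk0, h0], fun i hi => ?_, fun i => ?_⟩
      · simp only
        rw [if_neg (by omega), g1 _ (by omega)]
      · simp only
        rcases lt_trichotomy (i + 1) k with h | h | h
        · have hv : (if i + 2 < k then P (i + 2) else R (i + 2 - k)) = P (i + 2) := by
            split_ifs with h'
            · rfl
            · rw [show i + 2 - k = 0 by omega, g0, h1 _ (by omega)]
          rw [hv, if_pos h, if_pos (by omega)]
          exact h2 i
        · rw [if_neg (by omega), show i + 1 - k = 0 by omega, g0]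
          omega
        · rw [if_neg (by omega), if_neg (by omega), if_neg (by omega),
            show i + 1 - k = i - k + 1 by omega, show i + 2 - k = i - k + 2 by omega]
          exact g2 _
    refine ⟨hmem, firstReturn_eq hmem hk0 hk (by simp [g0]) fun i hi hik => ?_⟩
    simp only [if_pos hik]
    exact h3 i hi hik
  · rintro ⟨P, R⟩ ⟨P', R'⟩ ⟨⟨⟨-, h1, -⟩, -⟩, -⟩ ⟨⟨⟨-, h1', -⟩, -⟩, -⟩ h
    simp only at h h1 h1'
    rw [Prod.mk.injEq]
    constructor
    · ext i
      rcases lt_or_ge i k with hi | hi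
      · simpa [hi] using congrFun h i
      · rw [h1 i hi, h1' i hi]
    · ext i
      simpa using congrFun h (i + k)
  · rintro P ⟨⟨h0, h1, h2⟩, rfl⟩
    set k := firstReturn P with hkdef
    have hPk : P k = 0 := (firstReturn_spec hn ⟨h0, h1, h2⟩).2
    refine ⟨⟨fun i => if i < k then P i else 0, fun i => P (i + k)⟩, ⟨⟨⟨?_, ?_, ?_⟩, hk0, ?_⟩,
      ?_, ?_, ?_⟩, ?_⟩
    · simp [h0]
    · intro i hi
      simp only
      rw [if_neg (by omega)]
    · intro i
      simp only
      rcases lt_or_ge (i + 1) k with h | h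
      · have hv : (if i + 2 < k then P (i + 2) else 0) = P (i + 2) := by
          split_ifs with h'
          · rfl
          · rw [show i + 2 = k by omega, hPk]
        rw [hv, if_pos h, if_pos (by omega)]
        exact h2 i
      · rw [if_neg (by omega)]
        omega
    · intro i hi hik
      simp only [if_pos hik]
      exact ne_zero_of_lt_firstReturn hi hik
    · simpa using hPk
    · intro i hi
      exact h1 _ (by omega)
    · intro i
      have := h2 (i + k)
      simp only
      rw [show i + 1 + k = i + k + 1 by ring, show i + 2 + k = i + k + 2 by ring]
      exact this
    · ext i
      simp only
      split_ifs with h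
      · rfl
      · rw [Nat.sub_add_cancel (by omega)]

theorem sum_firstReturn {n : ℕ} (hn : 0 < n) (f : ℕ → ℕ) :
    ∑ P ∈ (finite_excursions n).toFinset, f (firstReturn P) =
      ∑ ij ∈ Finset.HasAntidiagonal.antidiagonal n,
        f ij.1 * (irreducibles ij.1).ncard * (excursions ij.2).ncard := by
  classical
  rw [Finset.Nat.sum_antidiagonal_eq_sum_range_succ
    (fun i j => f i * (irreducibles i).ncard * (excursions j).ncard),
    ← Finset.sum_fiberwise_of_maps_to (t := Finset.range (n + 1)) (g := firstReturn)]
  · refine Finset.sum_congr rfl fun k hk => ?_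
    have hkn : k ≤ n := Nat.lt_succ_iff.1 (Finset.mem_range.1 hk)
    rw [mul_assoc, ← ncard_firstReturn_eq hn hkn, Finset.sum_congr rfl (g := fun _ => f k),
      Finset.sum_const, smul_eq_mul, mul_comm, ← Set.ncard_coe_finset]
    · congr 2
      ext P
      simp
    · intro P hP
      rw [(Finset.mem_filter.1 hP).2]
  · intro P hP
    rw [Set.Finite.mem_toFinset] at hP
    exact Finset.mem_range.2 (Nat.lt_succ_iff.2 (firstReturn_le hn (hP.2.1 n le_rfl)))

theorem ncard_excursions {n : ℕ} (hn : 0 < n) :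
    (excursions n).ncard = ∑ ij ∈ Finset.HasAntidiagonal.antidiagonal n,
      (irreducibles ij.1).ncard * (excursions ij.2).ncard := by
  have := sum_firstReturn hn (fun _ => 1)
  simp only [Finset.sum_const, smul_eq_mul, mul_one, one_mul] at this
  rw [← this, Set.ncard_eq_toFinset_card _ (finite_excursions n)]

/-- The periodic extension of a path of length `n`. -/
def periodize (n : ℕ) (P : ℕ → ℕ) (i : ℤ) : ℤ := P (i % n).toNat

theorem periodize_apply {n : ℕ} (hn : 0 < n) {P : ℕ → ℕ} (hP : P ∈ excursions n) (q : ℤ) {j : ℕ}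
    (hj : j ≤ n) : periodize n P (n * q + j) = P j := by
  unfold periodize
  rcases hj.lt_or_eq with h | rfl
  · rw [Int.mul_add_emod_self_left, Int.emod_eq_of_lt (by omega) (by omega), Int.toNat_natCast]
  · rw [Int.mul_add_emod_self_left, Int.emod_self, hP.2.1 j le_rfl, Int.toNat_zero, hP.1]

theorem periodize_add {n : ℕ} (P : ℕ → ℕ) (i : ℤ) :
    periodize n P (i + n) = periodize n P i := by
  unfold periodize
  rw [Int.add_emod_right]

theorem periodize_natCast {n : ℕ} (hn : 0 < n) {P : ℕ → ℕ} (hP : P ∈ excursions n) {j : ℕ}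
    (hj : j ≤ n) : periodize n P j = P j := by
  simpa using periodize_apply hn hP 0 hj

theorem periodize_two_mul_le {n : ℕ} (hn : 0 < n) {P : ℕ → ℕ} (hP : P ∈ excursions n) (i : ℤ) :
    2 * periodize n P (i + 1) ≤ periodize n P i + periodize n P (i + 2) + 1 := by
  have hn' : (0 : ℤ) < n := by exact_mod_cast hn
  have hr0 := Int.emod_nonneg i hn'.ne'
  have hrn := Int.emod_lt_of_pos i hn'
  obtain ⟨r, hr⟩ := Int.eq_ofNat_of_zero_le hr0
  have hi : i = n * (i / n) + r := by rw [← hr]; exact (Int.mul_ediv_add_emod i n).symm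
  set q := i / n
  rw [hr] at hrn
  have hpos : ∀ j, 0 ≤ periodize n P j := fun j => Int.natCast_nonneg _
  rw [hi]
  rcases le_or_gt (r + 2) n with h | h
  · rw [show (n : ℤ) * q + r + 1 = n * q + (r + 1 : ℕ) by push_cast; ring,
      show (n : ℤ) * q + r + 2 = n * q + (r + 2 : ℕ) by push_cast; ring,
      periodize_apply hn hP q (by omega), periodize_apply hn hP q (by omega),
      periodize_apply hn hP q (by omega)]
    exact_mod_cast hP.2.2 r
  · have h1 : periodize n P (n * q + r + 1) = 0 := by
      rw [show (n : ℤ) * q + r + 1 = n * q + n by omega, periodize_apply hn hP q le_rfl,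
        hP.2.1 n le_rfl, Nat.cast_zero]
    rw [h1]
    have := hpos (n * q + r)
    have := hpos (n * q + r + 2)
    omega

theorem cyclicPaths_add_mul {n : ℕ} {Q : ℤ → ℤ} (hQ : ∀ i, Q (i + n) = Q i) (i q : ℤ) :
    Q (i + q * n) = Q i := by
  induction q using Int.induction_on with
  | zero => simp
  | succ q ih => rw [add_mul, one_mul, ← add_assoc, hQ, ih]
  | pred q ih => rw [← ih, ← hQ (i + (-q - 1) * n)]; congr 1; ring

/-- Cutting a cyclic path at its last minimum leaves an excursion together with a time before
its first return. -/
theorem ncard_cyclicPaths_eq_sum {n : ℕ} (hn : 0 < n) :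
    (cyclicPaths n).ncard = ∑ P ∈ (finite_excursions n).toFinset, firstReturn P := by
  classical
  have hsig : ∑ P ∈ (finite_excursions n).toFinset, firstReturn P =
      ((finite_excursions n).toFinset.sigma fun P => Finset.range (firstReturn P)).card := by
    rw [Finset.card_sigma]
    simp
  rw [hsig, ← Set.ncard_coe_finset]
  symm
  have hmem : ∀ p : (_ : ℕ → ℕ) × ℕ,
      p ∈ (((finite_excursions n).toFinset.sigma fun P => Finset.range (firstReturn P) :
        Finset ((_ : ℕ → ℕ) × ℕ)) : Set ((_ : ℕ → ℕ) × ℕ)) ↔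
      p.1 ∈ excursions n ∧ p.2 < firstReturn p.1 := fun p => by simp
  have hlen : ∀ {P : ℕ → ℕ}, P ∈ excursions n → firstReturn P ≤ n := fun hP =>
    firstReturn_le hn (hP.2.1 n le_rfl)
  refine Set.ncard_congr (fun p _ i => periodize n p.1 (i + p.2) - p.1 p.2) ?_ ?_ ?_
  · rintro ⟨P, o⟩ hp
    obtain ⟨hP, ho⟩ := (hmem _).1 hp
    simp only at hP ho
    have ho' := (ho.trans_le (hlen hP)).le
    refine ⟨?_, fun i => ?_, fun i => ?_⟩
    · simp only [zero_add]
      rw [periodize_natCast hn hP ho', sub_self]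
    · simp only
      rw [show i + n + o = i + o + n by ring, periodize_add]
    · simp only
      rw [show i + 1 + o = i + o + 1 by ring, show i + 2 + o = i + o + 2 by ring]
      linarith [periodize_two_mul_le hn hP (i + o)]
  · rintro ⟨P, o⟩ ⟨P', o'⟩ hp hp' h
    obtain ⟨hP, ho⟩ := (hmem _).1 hp
    obtain ⟨hP', ho'⟩ := (hmem _).1 hp'
    simp only at hP ho hP' ho' h
    have hpos : ∀ (P : ℕ → ℕ) j, 0 ≤ periodize n P j := fun P j => Int.natCast_nonneg _
    have hz : ∀ {P}, P ∈ excursions n → periodize n P 0 = 0 := fun {P} hP => by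
      have := periodize_natCast hn hP (Nat.zero_le n)
      rw [hP.1] at this
      exact_mod_cast this
    -- Evaluating at the two marked times compares the minima, giving `P o = P' o'`. If o ≠ o', one
    -- of the excursions would vanish at a positive time before its first return.
    have e1 := congrFun h (-o)
    have e2 := congrFun h (-o')
    simp only [neg_add_cancel, hz hP, hz hP'] at e1 e2
    have heq : (P o : ℤ) = P' o' := by
      have := hpos P' (-o + o')
      have := hpos P (-o' + o)
      omega
    have hoo : o = o' := by
      rcases lt_trichotomy o o' with hlt | heq' | hlt
      · exfalso
        rw [show (-o + o' : ℤ) = ((o' - o : ℕ) : ℤ) by omega,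
          periodize_natCast hn hP' (by have := hlen hP'; omega)] at e1
        exact ne_zero_of_lt_firstReturn (P := P') (k := o' - o) (by omega) (by omega) (by omega)
      · exact heq'
      · exfalso
        rw [show (-o' + o : ℤ) = ((o - o' : ℕ) : ℤ) by omega,
          periodize_natCast hn hP (by have := hlen hP; omega)] at e2
        exact ne_zero_of_lt_firstReturn (P := P) (k := o - o') (by omega) (by omega) (by omega)
    subst hoo
    have hPP : P = P' := by
      ext i
      rcases lt_or_ge i n with hi | hi
      · have := congrFun h (i - o)
        simp only [sub_add_cancel] at this
        rw [periodize_natCast hn hP hi.le, periodize_natCast hn hP' hi.le] at this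
        omega
      · rw [hP.2.1 i hi, hP'.2.1 i hi]
    rw [hPP]
  · rintro Q ⟨h0, h1, h2⟩
    have hmod : ∀ i : ℤ, Q i = Q (i % n) := fun i => by
      conv_lhs => rw [← Int.emod_add_ediv_mul i n]
      exact cyclicPaths_add_mul h1 _ _
    have hn' : (0 : ℤ) < n := by exact_mod_cast hn
    obtain ⟨i₀, -, hi₀⟩ := Finset.exists_min_image (Finset.range n) (fun i : ℕ => Q i)
      ⟨0, Finset.mem_range.2 hn⟩
    have hmin : ∀ i, Q i₀ ≤ Q i := fun i => by
      have ha := Int.emod_nonneg i hn'.ne'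
      have hb := Int.emod_lt_of_pos i hn'
      have := hi₀ (i % n).toNat (Finset.mem_range.2 (by omega))
      rw [Int.toNat_of_nonneg ha, ← hmod] at this
      exact this
    have hex : ∃ o : ℕ, Q (-o) = Q i₀ := by
      have hle : i₀ ≤ i₀ * n := Nat.le_mul_of_pos_right _ hn
      refine ⟨i₀ * n - i₀, ?_⟩
      rw [← cyclicPaths_add_mul h1 (i₀ : ℤ) (-i₀)]
      push_cast [hle]
      ring_nf
    -- The least o for which -o is a minimum is the last minimum at a time ≤ 0; minimality is what
    -- puts o before the first return.
    set o := Nat.find hex with ho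
    have hQo : Q (-o) = Q i₀ := Nat.find_spec hex
    have hlast : ∀ j : ℕ, j < o → Q (-j) ≠ Q i₀ := fun j hj => Nat.find_min hex hj
    have hon : o < n := by
      by_contra hcon
      refine hlast (o - n) (by omega) ?_
      rw [← hQo, ← h1 (-o)]
      congr 1
      omega
    set P : ℕ → ℕ := fun i => if i < n then (Q (i - o) - Q i₀).toNat else 0 with hPdef
    have hPval : ∀ i : ℕ, i ≤ n → (P i : ℤ) = Q (i - o) - Q i₀ := fun i hi => by
      simp only [hPdef]
      split_ifs with h
      · exact Int.toNat_of_nonneg (sub_nonneg.2 (hmin _))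
      · rw [show (i : ℤ) - o = -o + n by omega, h1, hQo, Nat.cast_zero, sub_self]
    have hPn : ∀ i, n ≤ i → P i = 0 := fun i hi => if_neg (by omega)
    have hP : P ∈ excursions n := by
      refine ⟨?_, hPn, fun i => ?_⟩
      · have := hPval 0 (Nat.zero_le _)
        rw [Nat.cast_zero, zero_sub, hQo, sub_self] at this
        exact_mod_cast this
      · rcases le_or_gt (i + 2) n with h | h
        · have e0 := hPval i (by omega)
          have e1 := hPval (i + 1) (by omega)
          have e2 := hPval (i + 2) h
          have := h2 (i - o)
          push_cast at e1 e2
          rw [show (i : ℤ) + 1 - o = i - o + 1 by ring] at e1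
          rw [show (i : ℤ) + 2 - o = i - o + 2 by ring] at e2
          omega
        · rw [hPn (i + 1) (by omega)]
          omega
    have hof : o < firstReturn P := by
      by_contra hcon
      obtain ⟨ha, hb⟩ := firstReturn_spec hn hP
      refine hlast (o - firstReturn P) (by omega) ?_
      have := hPval (firstReturn P) (by omega)
      rw [hb] at this
      rw [show (-((o - firstReturn P : ℕ) : ℤ)) = firstReturn P - o by omega]
      push_cast at this
      omega
    refine ⟨⟨P, o⟩, (hmem _).2 ⟨hP, hof⟩, ?_⟩
    ext i
    simp only
    have ha := Int.emod_nonneg (i + o) hn'.ne'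
    have hb := Int.emod_lt_of_pos (i + o) hn'
    have hper : periodize n P (i + o) = Q i - Q i₀ := by
      unfold periodize
      rw [hPval _ (by omega), Int.toNat_of_nonneg ha]
      congr 1
      rw [← cyclicPaths_add_mul h1 _ ((i + o) / n)]
      congr 1
      have := Int.emod_add_ediv_mul (i + o) n
      linarith
    rw [hper, hPval o hon.le, sub_self, h0]
    ring

theorem ncard_cyclicPaths {n : ℕ} (hn : 0 < n) :
    (cyclicPaths n).ncard = ∑ ij ∈ Finset.HasAntidiagonal.antidiagonal n,
      ij.1 * (irreducibles ij.1).ncard * (excursions ij.2).ncard := by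
  rw [ncard_cyclicPaths_eq_sum hn]
  exact sum_firstReturn hn fun k => k

/-! ### Landau's theorem -/

/-- The sum of the first `k` entries of `s`. -/
def prefixSum {n : ℕ} (s : Fin n → ℕ) (k : ℕ) : ℕ :=
  ∑ i ∈ Finset.univ.filter (fun i : Fin n => (i : ℕ) < k), s i

theorem prefixSum_zero {n : ℕ} (s : Fin n → ℕ) : prefixSum s 0 = 0 := by
  simp [prefixSum]

theorem prefixSum_succ {n : ℕ} (s : Fin n → ℕ) {k : ℕ} (hk : k < n) :
    prefixSum s (k + 1) = prefixSum s k + s ⟨k, hk⟩ := by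
  unfold prefixSum
  rw [show Finset.univ.filter (fun i : Fin n => (i : ℕ) < k + 1) =
      insert ⟨k, hk⟩ (Finset.univ.filter (fun i : Fin n => (i : ℕ) < k)) by
    ext i
    simp only [Finset.mem_filter, Finset.mem_univ, true_and, Finset.mem_insert, Fin.ext_iff]
    omega]
  rw [Finset.sum_insert (by simp), add_comm]

theorem prefixSum_of_le {n : ℕ} (s : Fin n → ℕ) {k : ℕ} (hk : n ≤ k) :
    prefixSum s k = ∑ i, s i := by
  unfold prefixSum
  rw [Finset.filter_true_of_mem fun i _ => i.2.trans_le hk]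

theorem choose_succ_two (k : ℕ) : (k + 1).choose 2 = k.choose 2 + k := by
  rw [Nat.choose_succ_succ' k 1, Nat.choose_one_right, add_comm]

-- Each game played inside U is won exactly once inside U.
open Classical in
theorem sum_card_adj {V : Type*} [DecidableEq V] {T : Digraph V} (hT : IsTournament T)
    (U : Finset V) : ∑ v ∈ U, (U.filter fun w => T.Adj v w).card = U.card.choose 2 := by
  induction U using Finset.induction_on with
  | empty => simp
  | insert a U ha ih =>
    have h1 : ∀ v ∈ U, ((insert a U).filter fun w => T.Adj v w).card =
        (U.filter fun w => T.Adj v w).card + if T.Adj v a then 1 else 0 := fun v _ => by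
      rw [Finset.filter_insert]
      split_ifs with h
      · rw [Finset.card_insert_of_notMem (by simp [ha])]
      · rfl
    have h2 : ((insert a U).filter fun w => T.Adj a w).card =
        ∑ v ∈ U, if T.Adj v a then 0 else 1 := by
      rw [Finset.filter_insert, if_neg (hT.1 a), Finset.card_filter]
      refine Finset.sum_congr rfl fun v hv => ?_
      have := hT.2 a v (fun h => ha (h ▸ hv))
      by_cases h : T.Adj v a <;> simp [this, h]
    rw [Finset.sum_insert ha, Finset.sum_congr rfl h1, Finset.sum_add_distrib, ih, h2,
      Finset.card_insert_of_notMem ha, choose_succ_two, add_left_comm, ← Finset.sum_add_distrib,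
      Finset.card_eq_sum_ones]
    congr 1
    exact Finset.sum_congr rfl fun v _ => by split_ifs <;> rfl

theorem wins_eq_card {V : Type*} [Fintype V] (T : Digraph V) [DecidableRel T.Adj] (v : V) :
    wins T v = (Finset.univ.filter fun w => T.Adj v w).card := by
  rw [wins, ← Set.ncard_coe_finset]
  congr 1
  ext w
  simp

theorem choose_card_le_sum_wins {n : ℕ} {T : Digraph (Fin n)} (hT : IsTournament T)
    (U : Finset (Fin n)) : U.card.choose 2 ≤ ∑ v ∈ U, wins T v := by
  classical
  rw [← sum_card_adj hT U]
  refine Finset.sum_le_sum fun v _ => ?_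
  rw [wins_eq_card]
  convert Finset.card_le_card (Finset.filter_subset_filter _ (Finset.subset_univ U))

theorem sum_wins {n : ℕ} {T : Digraph (Fin n)} (hT : IsTournament T) :
    ∑ v, wins T v = n.choose 2 := by
  classical
  have := sum_card_adj hT Finset.univ
  rw [Finset.card_univ, Fintype.card_fin] at this
  rw [← this]
  refine Finset.sum_congr rfl fun v _ => ?_
  rw [wins_eq_card]

theorem IsScoreSequence.choose_le {n : ℕ} {s : Fin n → ℕ} (hs : IsScoreSequence s) {k : ℕ}
    (hk : k ≤ n) : k.choose 2 ≤ prefixSum s k := by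
  obtain ⟨-, T, hT, σ, h⟩ := hs
  have h1 := choose_card_le_sum_wins hT
    ((Finset.univ.filter (fun i : Fin n => (i : ℕ) < k)).map σ.toEmbedding)
  rw [Finset.card_map, Finset.sum_map, Fin.card_filter_val_lt, min_eq_right hk] at h1
  simpa [prefixSum, h] using h1

theorem IsScoreSequence.sum_eq {n : ℕ} {s : Fin n → ℕ} (hs : IsScoreSequence s) :
    ∑ i, s i = n.choose 2 := by
  obtain ⟨-, T, hT, σ, h⟩ := hs
  rw [← sum_wins hT, ← Equiv.sum_comp σ (wins T)]
  exact Finset.sum_congr rfl fun i _ => h i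

/-- The element of U at position j, counted from 0, is at least j, so U picks entries no smaller
than the initial ones. -/
theorem prefixSum_card_le_sum {n : ℕ} {s : Fin n → ℕ} (hs : Monotone s) (U : Finset (Fin n)) :
    prefixSum s U.card ≤ ∑ i ∈ U, s i := by
  have hU : U.card ≤ n := by simpa using Finset.card_le_univ U
  set e := U.orderEmbOfFin rfl with he
  have hle : ∀ (m : ℕ) (h : m < U.card), m ≤ (e ⟨m, h⟩ : ℕ) := fun m => by
    induction m with
    | zero => intro _; exact Nat.zero_le _
    | succ m ih =>
      intro h
      refine (Nat.succ_le_succ (ih (by omega))).trans (Nat.succ_le_of_lt ?_)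
      exact e.strictMono (by simp [Fin.lt_def])
  have h1 : prefixSum s U.card = ∑ j : Fin U.card, s (Fin.castLE hU j) := by
    unfold prefixSum
    refine Eq.trans ?_ (Finset.sum_map Finset.univ (Fin.castLEEmb hU) s)
    congr 1
    ext i
    simp only [Finset.mem_filter, Finset.mem_univ, true_and, Finset.mem_map]
    constructor
    · intro h
      exact ⟨⟨i, h⟩, rfl⟩
    · rintro ⟨j, rfl⟩
      exact j.2
  have h2 : ∑ i ∈ U, s i = ∑ j : Fin U.card, s (e j) := by
    refine Eq.trans ?_ (Finset.sum_map Finset.univ e.toEmbedding s)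
    congr 1
    ext i
    rw [← Finset.mem_coe, ← Finset.range_orderEmbOfFin U rfl]
    simp [he]
  rw [h1, h2]
  exact Finset.sum_le_sum fun j _ => hs (hle j j.2)

/-- The sufficiency half of Landau's theorem, from Hall's marriage theorem: every edge chooses one
of the `s v` victories assigned to one of its end points `v`. -/
theorem isScoreSequence_of_choose_le {n : ℕ} {s : Fin n → ℕ} (hs : Monotone s)
    (h : ∀ k ≤ n, k.choose 2 ≤ prefixSum s k) (hsum : ∑ i, s i = n.choose 2) :
    IsScoreSequence s := by
  classical
  let E := {p : Fin n × Fin n // p.1 < p.2}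
  let t : E → Finset (Σ i : Fin n, Fin (s i)) := fun e =>
    Finset.univ.filter fun a => a.1 = e.1.1 ∨ a.1 = e.1.2
  have hlt : IsTournament (⟨fun v w => v < w⟩ : Digraph (Fin n)) :=
    ⟨fun v => lt_irrefl v, fun v w hvw => ⟨fun h => not_lt.2 h.le, fun h =>
      lt_of_le_of_ne (not_lt.1 h) hvw⟩⟩
  -- If U is the set of end points of F, then F has at most `U.card.choose 2` edges, which Landau's
  -- inequality bounds by the victories available at U. The pairs in U are counted with the
  -- transitive tournament.
  have hall : ∀ F : Finset E, F.card ≤ (F.biUnion t).card := fun F => by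
    set U : Finset (Fin n) := F.biUnion fun e => {e.1.1, e.1.2} with hU
    have h1 : F.biUnion t = U.sigma fun i => Finset.univ := by
      ext a
      simp only [t, hU, Finset.mem_biUnion, Finset.mem_filter, Finset.mem_univ, true_and,
        Finset.mem_sigma, and_true, Finset.mem_insert, Finset.mem_singleton]
    have h2 : F.card ≤ (U.sigma fun v => U.filter fun w => v < w).card := by
      refine Finset.card_le_card_of_injOn (fun e => ⟨e.1.1, e.1.2⟩) ?_ ?_
      · intro e he
        simp only [Finset.coe_sigma, Set.mem_sigma_iff, Finset.mem_coe, Finset.mem_filter, hU,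
          Finset.mem_biUnion, Finset.mem_insert, Finset.mem_singleton]
        exact ⟨⟨e, he, Or.inl rfl⟩, ⟨e, he, Or.inr rfl⟩, e.2⟩
      · intro e _ e' _ h
        simp only [Sigma.mk.injEq, heq_eq_eq] at h
        exact Subtype.ext (Prod.ext h.1 h.2)
    have h3 := sum_card_adj hlt U
    have h4 : (U.sigma fun v => U.filter fun w => v < w).card = U.card.choose 2 := by
      rw [Finset.card_sigma, ← h3]
      refine Finset.sum_congr rfl fun v _ => ?_
      congr
    rw [h1, Finset.card_sigma]
    simp only [Finset.card_univ, Fintype.card_fin]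
    exact (h2.trans h4.le).trans
      ((h _ (by simpa using Finset.card_le_univ U)).trans (prefixSum_card_le_sum hs U))
  obtain ⟨f, hf, hft⟩ := (Finset.all_card_le_biUnion_card_iff_exists_injective t).1 hall
  have hft' : ∀ e : E, (f e).1 = e.1.1 ∨ (f e).1 = e.1.2 := fun e => by
    simpa [t] using hft e
  let T : Digraph (Fin n) :=
    ⟨fun v w => ∃ e : E, (e.1 = (v, w) ∨ e.1 = (w, v)) ∧ (f e).1 = v⟩
  have hE : ∀ {v w : Fin n}, v ≠ w → ∃ e : E, ∀ e' : E,
      (e'.1 = (v, w) ∨ e'.1 = (w, v)) ↔ e' = e := fun {v w} hvw => by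
    rcases lt_or_gt_of_ne hvw with h | h
    · refine ⟨⟨(v, w), h⟩, fun e' => ⟨?_, fun h => Or.inl (h ▸ rfl)⟩⟩
      rintro (h' | h')
      · exact Subtype.ext h'
      · have := e'.2
        rw [h'] at this
        exact absurd this (not_lt.2 h.le)
    · refine ⟨⟨(w, v), h⟩, fun e' => ⟨?_, fun h => Or.inr (h ▸ rfl)⟩⟩
      rintro (h' | h')
      · have := e'.2
        rw [h'] at this
        exact absurd this (not_lt.2 h.le)
      · exact Subtype.ext h'
  have hT : IsTournament T := by
    refine ⟨?_, fun v w hvw => ?_⟩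
    · rintro v ⟨e, he, -⟩
      have := e.2
      rcases he with he | he <;> · rw [he] at this; exact lt_irrefl _ this
    · obtain ⟨e, he⟩ := hE hvw
      have h1 : T.Adj v w ↔ (f e).1 = v := by
        simp only [T, he, exists_eq_left]
      have h2 : T.Adj w v ↔ (f e).1 = w := by
        simp only [T, or_comm (a := _ = (w, v)), he, exists_eq_left]
      rw [h1, h2]
      constructor
      · rintro h h'
        exact hvw (h ▸ h')
      · intro h
        have := hft' e
        rcases (he e).2 rfl with h' | h' <;> rw [h'] at this <;> tauto
  -- Injectivity of the matching gives only an inequality; equal totals then force equality at every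
  -- vertex.
  have hwins : ∀ v, wins T v ≤ s v := fun v => by
    have h1 : s v = (Finset.univ.filter fun a : Σ i : Fin n, Fin (s i) => a.1 = v).card := by
      rw [show (Finset.univ.filter fun a : Σ i : Fin n, Fin (s i) => a.1 = v) =
        ({v} : Finset (Fin n)).sigma fun i => Finset.univ by ext a; simp]
      simp [Finset.card_sigma]
    rw [wins_eq_card, h1]
    rcases isEmpty_or_nonempty E with hE0 | hE0
    · rw [Finset.filter_false_of_mem fun w _ ⟨e, _⟩ => hE0.elim e, Finset.card_empty]
      exact Nat.zero_le _
    choose! g hg using fun (w : Fin n) (hw : w ∈ Finset.univ.filter fun w => T.Adj v w) =>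
      (Finset.mem_filter.1 hw).2
    have hinj : Set.InjOn g (Finset.univ.filter fun w => T.Adj v w) := fun w hw w' hw' hww => by
      have he := (hg w hw).1
      have he' := (hg w' hw').1
      rw [← hww] at he'
      rcases he with he | he <;> rcases he' with he' | he' <;> rw [he, Prod.mk.injEq] at he'
      · exact he'.2
      · exact he'.2.trans he'.1
      · exact he'.1.trans he'.2
      · exact he'.1
    refine Finset.card_le_card_of_injOn (fun w => f (g w)) (fun w hw => ?_)
      (hf.comp_injOn hinj)
    simpa using (hg w hw).2
  have heq : ∀ v, wins T v = s v := by
    have := (Finset.sum_eq_sum_iff_of_le (s := Finset.univ) fun v _ => hwins v).1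
      ((sum_wins hT).trans hsum.symm)
    exact fun v => this v (Finset.mem_univ v)
  exact ⟨hs, T, hT, 1, fun i => (heq i).symm⟩

/-! ### Score sequences as excursions -/

/-- The excess of the partial sums of `s` over those of the transitive tournament. -/
def excess {n : ℕ} (s : Fin n → ℕ) (k : ℕ) : ℕ := prefixSum s k - k.choose 2

theorem IsScoreSequence.excess_add {n : ℕ} {s : Fin n → ℕ} (hs : IsScoreSequence s) {k : ℕ}
    (hk : k ≤ n) : excess s k + k.choose 2 = prefixSum s k :=
  Nat.sub_add_cancel (hs.choose_le hk)

theorem IsScoreSequence.excess_of_le {n : ℕ} {s : Fin n → ℕ} (hs : IsScoreSequence s) {k : ℕ}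
    (hk : n ≤ k) : excess s k = 0 := by
  rw [excess, prefixSum_of_le s hk, hs.sum_eq]
  -- Beyond n the partial sums are constant, and truncated subtraction supplies the extension by
  -- zero.
  exact Nat.sub_eq_zero_of_le (Nat.choose_le_choose 2 hk)

theorem IsScoreSequence.excess_mem {n : ℕ} {s : Fin n → ℕ} (hs : IsScoreSequence s) :
    excess s ∈ excursions n := by
  refine ⟨by simp [excess, prefixSum_zero], fun i hi => hs.excess_of_le hi, fun i => ?_⟩
  rcases le_or_gt (i + 2) n with h | h
  · have h0 := hs.excess_add (k := i) (by omega)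
    have h1 := hs.excess_add (k := i + 1) (by omega)
    have h2 := hs.excess_add (k := i + 1 + 1) h
    rw [prefixSum_succ s (show i < n by omega), choose_succ_two] at h1
    rw [prefixSum_succ s (show i + 1 < n by omega), prefixSum_succ s (show i < n by omega),
      choose_succ_two, choose_succ_two] at h2
    have hm : s ⟨i, by omega⟩ ≤ s ⟨i + 1, by omega⟩ := hs.1 (by simp [Fin.le_def])
    change 2 * excess s (i + 1) ≤ excess s i + excess s (i + 1 + 1) + 1
    omega
  · rw [hs.excess_of_le (show n ≤ i + 1 by omega)]
    omega

theorem excess_injOn (n : ℕ) : Set.InjOn excess {s : Fin n → ℕ | IsScoreSequence s} := by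
  intro s hs s' hs' h
  have hp : ∀ k ≤ n, prefixSum s k = prefixSum s' k := fun k hk => by
    rw [← IsScoreSequence.excess_add hs hk, ← IsScoreSequence.excess_add hs' hk, h]
  ext i
  have h1 := hp (i + 1) i.2
  rw [prefixSum_succ s i.2, prefixSum_succ s' i.2, hp i i.2.le] at h1
  exact Nat.add_left_cancel h1

theorem exists_excess_eq {n : ℕ} {P : ℕ → ℕ} (hP : P ∈ excursions n) :
    ∃ s : Fin n → ℕ, IsScoreSequence s ∧ excess s = P := by
  obtain ⟨h0, h1, h2⟩ := hP
  -- The first step is nonnegative and steps drop by at most 1, so step i is at least -i; hence the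
  -- subtraction defining the scores is never truncated.
  have hle : ∀ i, P i ≤ P (i + 1) + i := fun i => by
    induction i with
    | zero => omega
    | succ i ih =>
      have h3 : 2 * P (i + 1) ≤ P i + P (i + 1 + 1) + 1 := h2 i
      omega
  have hmono : Monotone fun i => P (i + 1) + i - P i := monotone_nat_of_le_succ fun i => by
    have h3 : 2 * P (i + 1) ≤ P i + P (i + 1 + 1) + 1 := h2 i
    have := hle i
    have := hle (i + 1)
    omega
  have hpre : ∀ k ≤ n,
      prefixSum (fun i : Fin n => P (i + 1) + i - P i) k = P k + k.choose 2 := fun k => by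
    induction k with
    | zero => intro _; simp [prefixSum_zero, h0]
    | succ k ih =>
      intro hk
      rw [prefixSum_succ _ hk, ih (by omega), choose_succ_two]
      have := hle k
      simp only
      omega
  have hs : IsScoreSequence fun i : Fin n => P (i + 1) + i - P i := by
    refine isScoreSequence_of_choose_le (fun i j hij => hmono hij) (fun k hk => ?_) ?_
    · rw [hpre k hk]; omega
    · rw [← prefixSum_of_le _ le_rfl, hpre n le_rfl, h1 n le_rfl, zero_add]
  refine ⟨_, hs, ?_⟩
  ext k
  rcases le_or_gt k n with hk | hk
  · have := hs.excess_add hk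
    rw [hpre k hk] at this
    omega
  · rw [hs.excess_of_le hk.le, h1 k hk.le]

theorem irreducibleSubscores_eq_one_iff {n : ℕ} {s : Fin n → ℕ} (hs : IsScoreSequence s) :
    irreducibleSubscores s = 1 ↔ 0 < n ∧ ∀ i, 0 < i → i < n → excess s i ≠ 0 := by
  have hz : ∀ k ≤ n, prefixSum s k = k.choose 2 ↔ excess s k = 0 := fun k hk => by
    have := hs.excess_add hk
    omega
  have hfilter : irreducibleSubscores s =
      ((Finset.Icc 1 n).filter fun k => excess s k = 0).card := by
    unfold irreducibleSubscores
    congr 1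
    refine Finset.filter_congr fun k hk => ?_
    exact hz k (Finset.mem_Icc.1 hk).2
  rw [hfilter]
  rcases Nat.eq_zero_or_pos n with rfl | hn
  · simp
  have hmem : n ∈ (Finset.Icc 1 n).filter fun k => excess s k = 0 := by
    simp only [Finset.mem_filter, Finset.mem_Icc]
    exact ⟨⟨hn, le_rfl⟩, hs.excess_of_le le_rfl⟩
  constructor
  · intro h
    refine ⟨hn, fun i hi hin h0 => ?_⟩
    have hi' : i ∈ (Finset.Icc 1 n).filter fun k => excess s k = 0 := by
      simp only [Finset.mem_filter, Finset.mem_Icc]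
      exact ⟨⟨hi, hin.le⟩, h0⟩
    exact hin.ne (Finset.card_le_one.1 h.le i hi' n hmem)
  · rintro ⟨-, h⟩
    rw [Finset.card_eq_one]
    refine ⟨n, Finset.eq_singleton_iff_unique_mem.2 ⟨hmem, fun i hi => ?_⟩⟩
    simp only [Finset.mem_filter, Finset.mem_Icc] at hi
    by_contra hne
    exact h i hi.1.1 (by omega) hi.2

theorem S_eq_ncard_excursions (n : ℕ) : S n = (excursions n).ncard := by
  rw [S, ← (excess_injOn n).ncard_image]
  congr 1
  ext P
  constructor
  · rintro ⟨s, hs, rfl⟩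
    exact IsScoreSequence.excess_mem hs
  · exact exists_excess_eq

theorem Sm_one_eq_ncard_irreducibles (n : ℕ) : Sm n 1 = (irreducibles n).ncard := by
  rw [Sm, ← ((excess_injOn n).mono fun s hs => hs.1).ncard_image]
  congr 1
  ext P
  constructor
  · rintro ⟨s, ⟨hs, h⟩, rfl⟩
    exact ⟨hs.excess_mem, (irreducibleSubscores_eq_one_iff hs).1 h⟩
  · rintro ⟨hP, h⟩
    obtain ⟨s, hs, rfl⟩ := exists_excess_eq hP
    exact ⟨s, ⟨hs, (irreducibleSubscores_eq_one_iff hs).2 h⟩, rfl⟩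

/-! ### From cyclic paths to subsets with sum divisible by n -/

/-- Bi-infinite non-decreasing integer sequences that increase by `n` over each period `n`. -/
def quasiPeriodic (n : ℕ) : Set (ℤ → ℤ) :=
  {s | (∀ i, s i ≤ s (i + 1)) ∧ ∀ i, s (i + n) = s i + n}

theorem quasiPeriodic_add_mul {n : ℕ} {s : ℤ → ℤ} (hs : s ∈ quasiPeriodic n) (i q : ℤ) :
    s (i + q * n) = s i + q * n := by
  induction q using Int.induction_on with
  | zero => simp
  | succ q ih => rw [add_mul, one_mul, ← add_assoc, hs.2, ih, add_assoc]
  | pred q ih =>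
    have := hs.2 (i + (-q - 1) * n)
    rw [show i + (-q - 1 : ℤ) * n + n = i + -q * n by ring, ih] at this
    linarith

theorem quasiPeriodic_comp_add {n : ℕ} {s : ℤ → ℤ} (hs : s ∈ quasiPeriodic n) (c : ℤ) :
    (fun i => s (i + c)) ∈ quasiPeriodic n :=
  ⟨fun i => by simp only; rw [add_right_comm]; exact hs.1 _,
    fun i => by simp only; rw [add_right_comm]; exact hs.2 _⟩

/-- A shift by one replaces an entry by the same entry one period later, which is larger by n. -/
theorem sum_quasiPeriodic_comp_add {n : ℕ} {s : ℤ → ℤ} (hs : s ∈ quasiPeriodic n) (c : ℤ) :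
    ∑ i ∈ Finset.range n, (s (i + c) - i) = ∑ i ∈ Finset.range n, (s i - i) + n * c := by
  have step : ∀ c : ℤ, ∑ i ∈ Finset.range n, (s (i + (c + 1)) - i) =
      ∑ i ∈ Finset.range n, (s (i + c) - i) + n := fun c => by
    have h := Finset.sum_range_sub (fun i : ℕ => s (i + c)) n
    rw [Nat.cast_zero, zero_add, add_comm (n : ℤ), hs.2, add_sub_cancel_left] at h
    rw [← sub_eq_iff_eq_add', ← Finset.sum_sub_distrib, ← h]
    refine Finset.sum_congr rfl fun i _ => ?_
    push_cast
    rw [show (i : ℤ) + 1 + c = i + (c + 1) by ring]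
    ring
  induction c using Int.induction_on with
  | zero => simp
  | succ c ih => rw [step, ih]; ring
  | pred c ih =>
    have := step (-c - 1)
    rw [sub_add_cancel, ih] at this
    linarith

theorem eq_of_cyclicPaths_diff {Q Q' : ℤ → ℤ} (h0 : Q 0 = Q' 0)
    (h : ∀ i, Q (i + 1) - Q i = Q' (i + 1) - Q' i) : Q = Q' := by
  ext i
  induction i using Int.induction_on with
  | zero => exact h0
  | succ i ih => have := h i; linarith
  | pred i ih =>
    have := h (-i - 1)
    rw [sub_add_cancel] at this
    linarith

/-- Adding i to the i-th step turns "drops by at most 1" into monotonicity; closing up after n steps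
becomes the vanishing of the period sum. -/
theorem ncard_cyclicPaths_eq {n : ℕ} (hn : 0 < n) :
    (cyclicPaths n).ncard =
      {s | s ∈ quasiPeriodic n ∧ ∑ i ∈ Finset.range n, (s i - i) = 0}.ncard := by
  refine Set.ncard_congr (fun Q _ i => Q (i + 1) - Q i + i) ?_ ?_ ?_
  · rintro Q ⟨h0, h1, h2⟩
    refine ⟨⟨fun i => ?_, fun i => ?_⟩, ?_⟩
    · have := h2 i
      simp only
      rw [add_assoc i 1 1, one_add_one_eq_two]
      linarith
    · simp only
      rw [add_right_comm, h1, h1]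
      ring
    · have h := Finset.sum_range_sub (fun i : ℕ => Q i) n
      have hQn := h1 0
      rw [zero_add] at hQn
      rw [Nat.cast_zero, hQn, sub_self] at h
      rw [← h]
      exact Finset.sum_congr rfl fun i _ => by push_cast; ring
  · rintro Q Q' ⟨h0, -⟩ ⟨h0', -⟩ h
    refine eq_of_cyclicPaths_diff (h0.trans h0'.symm) fun i => ?_
    have := congrFun h i
    linarith
  · rintro s ⟨hs, hsum⟩
    have hn' : (0 : ℤ) < n := by exact_mod_cast hn
    set F : ℕ → ℤ := fun m => ∑ j ∈ Finset.range m, (s j - j) with hF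
    set Q : ℤ → ℤ := fun i => F (i % n).toNat with hQ
    have hper : ∀ i, Q (i + n) = Q i := fun i => by simp only [hQ, Int.add_emod_right]
    have hdiff : ∀ i, Q (i + 1) - Q i = s i - i := fun i => by
      have ha := Int.emod_nonneg i hn'.ne'
      have hb := Int.emod_lt_of_pos i hn'
      have hi := Int.emod_add_ediv_mul i n
      set q := i / n
      obtain ⟨r, hr⟩ := Int.eq_ofNat_of_zero_le ha
      have hx : s i - i = s r - r := by
        rw [← hi, quasiPeriodic_add_mul hs, hr]
        ring
      have hQi : Q i = F r := by simp only [hQ, hr, Int.toNat_natCast]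
      have hQi1 : Q (i + 1) = F (r + 1) := by
        simp only [hQ]
        rw [← hi, hr, show (r : ℤ) + q * n + 1 = (r + 1 : ℕ) + q * n by push_cast; ring,
          Int.add_mul_emod_self_right]
        rcases lt_or_ge (r + 1) n with h | h
        · rw [Int.emod_eq_of_lt (by omega) (by omega), Int.toNat_natCast]
        · rw [show r + 1 = n by omega, Int.emod_self, Int.toNat_zero]
          simp only [hF, hsum, Finset.range_zero, Finset.sum_empty]
      rw [hQi, hQi1, hx]
      simp only [hF, Finset.sum_range_succ, add_sub_cancel_left]
    refine ⟨Q, ⟨?_, hper, fun i => ?_⟩, ?_⟩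
    · simp [hQ, hF]
    · have h1 := hdiff i
      have h2 := hdiff (i + 1)
      have h3 := hs.1 i
      rw [add_assoc, one_add_one_eq_two] at h2
      linarith
    · ext i
      simp only [hdiff, sub_add_cancel]

theorem quasiPeriodic_monotone {n : ℕ} {s : ℤ → ℤ} (hs : s ∈ quasiPeriodic n) : Monotone s :=
  monotone_int_of_le_succ hs.1

theorem exists_crossing {n : ℕ} (hn : 0 < n) {s : ℤ → ℤ} (hs : s ∈ quasiPeriodic n) :
    ∃ c, s (c - 1) < 0 ∧ 0 ≤ s c := by
  have hn' : (1 : ℤ) ≤ n := by exact_mod_cast hn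
  have habs := neg_abs_le (s 0)
  have habs' := le_abs_self (s 0)
  have h0 := abs_nonneg (s 0)
  obtain ⟨c, hc, hmin⟩ := Int.exists_least_of_bdd (P := fun z => 0 ≤ s z)
    ⟨-(|s 0| + 1) * n, fun z hz => by
      by_contra hlt
      have h1 := quasiPeriodic_monotone hs (not_le.1 hlt).le
      have h2 := quasiPeriodic_add_mul hs 0 (-(|s 0| + 1))
      rw [zero_add] at h2
      nlinarith⟩
    ⟨|s 0| * n, by
      have h2 := quasiPeriodic_add_mul hs 0 |s 0|
      rw [zero_add] at h2
      nlinarith⟩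
  refine ⟨c, ?_, hc⟩
  by_contra h
  have := hmin _ (not_lt.1 h)
  omega

theorem crossing_unique {s : ℤ → ℤ} (hs : Monotone s) {c d : ℤ} (hc : s (c - 1) < 0)
    (hc' : 0 ≤ s c) (hd : s (d - 1) < 0) (hd' : 0 ≤ s d) : c = d := by
  by_contra hne
  rcases lt_or_gt_of_ne hne with h | h
  · have := hs (show c ≤ d - 1 by omega)
    omega
  · have := hs (show d ≤ c - 1 by omega)
    omega

/-- Among the sequences whose period sum is divisible by `n`, every shift class has one
representative with period sum `0`, and one that becomes non-negative at `0`. -/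
theorem ncard_crossing_eq {n : ℕ} (hn : 0 < n) :
    {s | s ∈ quasiPeriodic n ∧ (n : ℤ) ∣ ∑ i ∈ Finset.range n, (s i - i) ∧ s (-1) < 0 ∧
        0 ≤ s 0}.ncard =
      {s | s ∈ quasiPeriodic n ∧ ∑ i ∈ Finset.range n, (s i - i) = 0}.ncard := by
  have hn' : (n : ℤ) ≠ 0 := by exact_mod_cast hn.ne'
  refine Set.ncard_congr
    (fun s _ i => s (i + -((∑ i ∈ Finset.range n, (s i - i)) / n))) ?_ ?_ ?_
  · rintro s ⟨hs, hdvd, -⟩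
    refine ⟨quasiPeriodic_comp_add hs _, ?_⟩
    rw [sum_quasiPeriodic_comp_add hs, mul_neg, Int.mul_ediv_cancel' hdvd, add_neg_cancel]
  · rintro s s' ⟨hs, -, h1, h2⟩ ⟨hs', -, h1', h2'⟩ h
    set c := (∑ i ∈ Finset.range n, (s i - i)) / n
    set c' := (∑ i ∈ Finset.range n, (s' i - i)) / n
    have hcc : c = c' := by
      have e1 := congrFun h (c' - 1)
      have e2 := congrFun h c'
      simp only [add_neg_cancel] at e1 e2
      rw [show c' - 1 + -c' = -1 by ring] at e1
      have := crossing_unique (quasiPeriodic_monotone hs) (c := 0) (d := c' + -c)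
        (by simpa using h1) h2 (by rw [← e1] at h1'; convert h1' using 2; ring)
        (by rw [e2]; exact h2')
      omega
    ext i
    have := congrFun h (i + c)
    simp only [← hcc, add_neg_cancel_right] at this
    exact this
  · rintro s ⟨hs, hsum⟩
    obtain ⟨c, hc1, hc2⟩ := exists_crossing hn hs
    have hsum' : ∑ i ∈ Finset.range n, (s (i + c) - i) = n * c := by
      rw [sum_quasiPeriodic_comp_add hs, hsum, zero_add]
    refine ⟨fun i => s (i + c), ⟨quasiPeriodic_comp_add hs c, ?_, ?_, ?_⟩, ?_⟩
    · simp only [hsum', dvd_mul_right]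
    · simp only
      rwa [neg_add_eq_sub]
    · simpa using hc2
    · ext i
      simp only [hsum', Int.mul_ediv_cancel_left _ hn', neg_add_cancel_right]

theorem eq_of_eqOn_period {n : ℕ} (hn : 0 < n) {s s' : ℤ → ℤ} (hs : s ∈ quasiPeriodic n)
    (hs' : s' ∈ quasiPeriodic n) (h : ∀ r : ℕ, r < n → s r = s' r) : s = s' := by
  have hn' : (0 : ℤ) < n := by exact_mod_cast hn
  ext i
  have ha := Int.emod_nonneg i hn'.ne'
  have hb := Int.emod_lt_of_pos i hn'
  obtain ⟨r, hr⟩ := Int.eq_ofNat_of_zero_le ha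
  rw [← Int.emod_add_ediv_mul i n, quasiPeriodic_add_mul hs, quasiPeriodic_add_mul hs', hr,
    h r (by omega)]

/-- Send s to the set of values s i + i + 1 for 0 ≤ i < n. Adding i makes s strictly increasing; 0 ≤
s 0 bounds the least element below by 1, and s (-1) < 0, that is s (n - 1) < n, bounds the greatest
by 2n - 1. As the odd numbers 2i + 1 sum to n^2, divisibility by n is preserved. -/
theorem N_eq_ncard_crossing {n : ℕ} (hn : 0 < n) :
    N n = {s | s ∈ quasiPeriodic n ∧ (n : ℤ) ∣ ∑ i ∈ Finset.range n, (s i - i) ∧ s (-1) < 0 ∧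
        0 ≤ s 0}.ncard := by
  have hn' : (0 : ℤ) < n := by exact_mod_cast hn
  have hodd : ∑ i ∈ Finset.range n, (2 * (i : ℤ) + 1) = n * n := by
    clear hn hn'
    induction n with
    | zero => simp
    | succ n ih => rw [Finset.sum_range_succ, ih]; push_cast; ring
  rw [N, ← Set.ncard_coe_finset]
  symm
  have hmono : ∀ {s : ℤ → ℤ}, s ∈ quasiPeriodic n → 0 ≤ s 0 →
      StrictMono fun i : Fin n => (s (i : ℕ) + (i : ℕ) + 1).toNat := fun {s} hs h0 i j hij => by
    have h1 := quasiPeriodic_monotone hs (show ((i : ℕ) : ℤ) ≤ (j : ℕ) by exact_mod_cast hij.le)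
    have h2 := quasiPeriodic_monotone hs (show 0 ≤ ((i : ℕ) : ℤ) by omega)
    have h3 : (i : ℕ) < j := hij
    simp only
    omega
  have hcard : ∀ {s : ℤ → ℤ}, s ∈ quasiPeriodic n → 0 ≤ s 0 →
      (Finset.univ.image fun i : Fin n => (s (i : ℕ) + (i : ℕ) + 1).toNat).card = n :=
    fun hs h0 => by
      rw [Finset.card_image_of_injective _ (hmono hs h0).injective, Finset.card_univ,
        Fintype.card_fin]
  have hsum : ∀ {s : ℤ → ℤ}, s ∈ quasiPeriodic n → 0 ≤ s 0 →
      ((∑ a ∈ Finset.univ.image fun i : Fin n => (s (i : ℕ) + (i : ℕ) + 1).toNat, a : ℕ) : ℤ) =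
        ∑ i ∈ Finset.range n, (s i - i) + n * n := fun {s} hs h0 => by
    rw [Finset.sum_image fun i _ j _ h => (hmono hs h0).injective h, ← hodd,
      ← Finset.sum_add_distrib, ← Fin.sum_univ_eq_sum_range
        (fun i : ℕ => s i - i + (2 * (i : ℤ) + 1)), Nat.cast_sum]
    refine Finset.sum_congr rfl fun i _ => ?_
    have h2 := quasiPeriodic_monotone hs (show 0 ≤ ((i : ℕ) : ℤ) by omega)
    rw [Int.toNat_of_nonneg (by omega)]
    ring
  refine Set.ncard_congr
    (fun s _ => Finset.univ.image fun i : Fin n => (s (i : ℕ) + (i : ℕ) + 1).toNat) ?_ ?_ ?_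
  · rintro s ⟨hs, hdvd, h1, h0⟩
    simp only [Finset.coe_filter, Finset.mem_powersetCard, Set.mem_ofPred_eq]
    refine ⟨⟨?_, hcard hs h0⟩, ?_⟩
    · intro a ha
      obtain ⟨i, -, rfl⟩ := Finset.mem_image.1 ha
      have h2 := quasiPeriodic_monotone hs (show 0 ≤ ((i : ℕ) : ℤ) by omega)
      have h3 := quasiPeriodic_monotone hs (show ((i : ℕ) : ℤ) ≤ -1 + n by omega)
      rw [hs.2] at h3
      rw [Finset.mem_Icc]
      omega
    · rw [← Int.natCast_dvd_natCast, hsum hs h0]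
      exact dvd_add hdvd (dvd_mul_right _ _)
  · rintro s s' ⟨hs, -, -, h0⟩ ⟨hs', -, -, h0'⟩ h
    have e1 := Finset.orderEmbOfFin_unique (hcard hs h0)
      (fun i => Finset.mem_image_of_mem _ (Finset.mem_univ i)) (hmono hs h0)
    have e2 := Finset.orderEmbOfFin_unique (hcard hs h0)
      (fun i => h ▸ Finset.mem_image_of_mem _ (Finset.mem_univ i)) (hmono hs' h0')
    refine eq_of_eqOn_period hn hs hs' fun r hr => ?_
    have e3 := congrFun (e1.trans e2.symm) ⟨r, hr⟩
    simp only at e3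
    have h2 := quasiPeriodic_monotone hs (show 0 ≤ (r : ℤ) by omega)
    have h2' := quasiPeriodic_monotone hs' (show 0 ≤ (r : ℤ) by omega)
    omega
  · intro A hA
    simp only [Finset.coe_filter, Finset.mem_powersetCard, Set.mem_ofPred_eq] at hA
    obtain ⟨⟨hA1, hA2⟩, hA3⟩ := hA
    set e := A.orderEmbOfFin hA2 with he
    have hmem : ∀ i, 1 ≤ e i ∧ e i ≤ 2 * n - 1 := fun i =>
      Finset.mem_Icc.1 (hA1 (Finset.orderEmbOfFin_mem A hA2 i))
    set a : ℕ → ℤ := fun r => if h : r < n then (e ⟨r, h⟩ : ℤ) else 0 with ha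
    set s : ℤ → ℤ := fun i => a (i % n).toNat - i % n - 1 + n * (i / n) with hsdef
    have hval : ∀ (r : ℕ) (q : ℤ), r < n → s (r + n * q) = a r - r - 1 + n * q := fun r q hr => by
      simp only [hsdef]
      rw [Int.add_mul_emod_self_left, Int.add_mul_ediv_left _ _ hn'.ne',
        Int.emod_eq_of_lt (by omega) (by omega), Int.ediv_eq_zero_of_lt (by omega) (by omega),
        Int.toNat_natCast, zero_add]
    have hval0 : ∀ r : ℕ, r < n → s r = a r - r - 1 := fun r hr => by
      simpa using hval r 0 hr
    have ha1 : ∀ r, r < n → 1 ≤ a r := fun r hr => by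
      simp only [ha, dif_pos hr]
      exact_mod_cast (hmem _).1
    have ha2 : ∀ r, r < n → a r ≤ 2 * n - 1 := fun r hr => by
      simp only [ha, dif_pos hr]
      have := (hmem ⟨r, hr⟩).2
      omega
    have ha3 : ∀ r, r + 1 < n → a r < a (r + 1) := fun r hr => by
      simp only [ha, dif_pos hr, dif_pos (show r < n by omega)]
      exact_mod_cast e.strictMono (by simp [Fin.lt_def])
    have hs : s ∈ quasiPeriodic n := by
      refine ⟨fun i => ?_, fun i => ?_⟩
      · have hr0 := Int.emod_nonneg i hn'.ne'
        have hrn := Int.emod_lt_of_pos i hn'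
        have hi := Int.emod_add_mul_ediv i n
        set q := i / n
        obtain ⟨r, hr⟩ := Int.eq_ofNat_of_zero_le hr0
        rw [hr] at hrn hi
        have hrn' : r < n := by omega
        rw [← hi, hval r q hrn']
        rcases lt_or_ge (r + 1) n with h | h
        · rw [show (r : ℤ) + n * q + 1 = (r + 1 : ℕ) + n * q by push_cast; ring, hval _ q h]
          have := ha3 r h
          push_cast
          linarith
        · rw [show (r : ℤ) + n * q + 1 = (0 : ℕ) + n * (q + 1) by
            have : (n : ℤ) = r + 1 := by omega
            rw [this]; push_cast; ring, hval _ _ hn]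
          have h1 := ha1 0 hn
          have h2 := ha2 r hrn'
          have h3 : (n : ℤ) = r + 1 := by omega
          rw [mul_add, mul_one]
          push_cast
          linarith
      · simp only [hsdef, Int.add_emod_right]
        rw [Int.add_ediv_of_dvd_right (dvd_refl _), Int.ediv_self hn'.ne']
        ring
    have h0 : 0 ≤ s 0 := by
      have := hval0 0 hn
      have := ha1 0 hn
      rw [Nat.cast_zero] at *
      omega
    have h1 : s (-1) < 0 := by
      have e1 := hval (n - 1) (-1) (by omega)
      have e2 := ha2 (n - 1) (by omega)
      rw [show ((n - 1 : ℕ) : ℤ) + n * -1 = -1 by omega] at e1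
      rw [e1]
      omega
    have himage : (Finset.univ.image fun i : Fin n => (s (i : ℕ) + (i : ℕ) + 1).toNat) = A := by
      have hfun : ∀ i : Fin n, (s (i : ℕ) + (i : ℕ) + 1).toNat = e i := fun i => by
        rw [hval0 i i.2]
        simp only [ha, dif_pos i.2, Fin.eta]
        omega
      ext x
      rw [← Finset.mem_coe (s := A), ← Finset.range_orderEmbOfFin A hA2]
      simp [hfun, he]
    refine ⟨s, ⟨hs, ?_, h1, h0⟩, himage⟩
    have := hsum hs h0
    rw [himage] at this
    rw [← Int.natCast_dvd_natCast, this] at hA3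
    exact (dvd_add_left (dvd_mul_right _ _)).1 hA3

theorem N_eq_ncard_cyclicPaths {n : ℕ} (hn : 0 < n) : N n = (cyclicPaths n).ncard := by
  rw [N_eq_ncard_crossing hn, ncard_crossing_eq hn, ncard_cyclicPaths_eq hn]

/-! ### A roots-of-unity filter for N_n -/

open Polynomial in
theorem prod_X_add_C_pow_of_isPrimitiveRoot {ω : ℂ} {d : ℕ} (hd : 0 < d)
    (hω : IsPrimitiveRoot ω d) (m : ℕ) :
    ∏ a ∈ Finset.range (d * m), (X + C (ω ^ (a + 1))) = (X ^ d - C ((-1) ^ d)) ^ m := by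
  have h1 : ∏ a ∈ Finset.range d, (X + C (ω ^ (a + 1))) = X ^ d - C ((-1) ^ d) := by
    rw [X_pow_sub_C_eq_prod hω hd (α := -ω) (by rw [neg_pow, hω.pow_eq_one, mul_one])]
    refine Finset.prod_congr rfl fun a _ => ?_
    rw [pow_succ, mul_neg, C_neg, sub_neg_eq_add]
  induction m with
  | zero => simp
  | succ m ih =>
    rw [mul_add, mul_one, Finset.prod_range_add, ih, pow_succ, ← h1]
    congr 1
    refine Finset.prod_congr rfl fun a _ => ?_
    rw [add_assoc, pow_add, pow_mul, hω.pow_eq_one, one_pow, one_mul]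

-- The sum is an elementary symmetric function of the powers of ω. These run through 2g full
-- periods, so it is a coefficient of (X^d - (-1)^d)^(2g).
open Polynomial in
theorem sum_powersetCard_of_isPrimitiveRoot {ω : ℂ} {d g : ℕ} (hd : 0 < d)
    (hω : IsPrimitiveRoot ω d) :
    ∑ A ∈ (Finset.Icc 1 (2 * (d * g))).powersetCard (d * g), ω ^ ∑ a ∈ A, a =
      (-1) ^ (d * g + g) * ((2 * g).choose g : ℂ) := by
  have h1 := Finset.prod_X_add_C_coeff (Finset.Icc 1 (2 * (d * g))) (fun a => ω ^ a)
    (k := d * g) (by rw [Nat.card_Icc]; omega)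
  rw [Nat.card_Icc, show 2 * (d * g) + 1 - 1 - d * g = d * g by omega] at h1
  have h2 : ∏ a ∈ Finset.Icc 1 (2 * (d * g)), (X + C (ω ^ a)) =
      expand ℂ d ((X + C (-(-1) ^ d)) ^ (2 * g)) := by
    rw [show Finset.Icc 1 (2 * (d * g)) = Finset.Ico 1 (2 * (d * g) + 1) from rfl,
      Finset.prod_Ico_eq_prod_range]
    simp only [Nat.add_sub_cancel, add_comm 1]
    rw [show 2 * (d * g) = d * (2 * g) by ring, prod_X_add_C_pow_of_isPrimitiveRoot hd hω]
    simp [sub_eq_add_neg]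
  rw [h2, mul_comm d g, coeff_expand_mul hd, coeff_X_add_C_pow] at h1
  rw [mul_comm d g]
  simp only [← Finset.prod_pow_eq_pow_sum]
  rw [← h1, show 2 * g - g = g by omega]
  congr 1
  rw [neg_pow, ← pow_mul, pow_add, mul_comm d g, mul_comm]

theorem sum_pow_of_isPrimitiveRoot {ζ : ℂ} {n : ℕ} (hζ : IsPrimitiveRoot ζ n) (m : ℕ) :
    ∑ j ∈ Finset.range n, (ζ ^ j) ^ m = if n ∣ m then (n : ℂ) else 0 := by
  split_ifs with h
  · rw [Finset.sum_congr rfl (g := fun _ => 1), Finset.sum_const, Finset.card_range, nsmul_one]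
    intro j _
    rw [← pow_mul, mul_comm, pow_mul, (hζ.pow_eq_one_iff_dvd m).2 h, one_pow]
  · have h1 : ζ ^ m ≠ 1 := fun h1 => h ((hζ.pow_eq_one_iff_dvd m).1 h1)
    have h2 := mul_geom_sum (ζ ^ m) n
    rw [← pow_mul, mul_comm m, pow_mul, hζ.pow_eq_one, one_pow, sub_self] at h2
    rw [← (mul_eq_zero.1 h2).resolve_left (sub_ne_zero.2 h1)]
    exact Finset.sum_congr rfl fun j _ => by rw [← pow_mul, mul_comm, pow_mul]

/-- Complementation in {1, …, 2n} preserves size n, and divisibility because the total n(2n + 1) is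
a multiple of n; it exchanges sets with and without 2n. The larger ground set is needed for the
products over roots of unity to cover whole periods. -/
theorem card_powersetCard_dvd_eq_two_mul_N {n : ℕ} (hn : 0 < n) :
    (((Finset.Icc 1 (2 * n)).powersetCard n).filter fun A => n ∣ ∑ a ∈ A, a).card = 2 * N n := by
  rw [← Finset.card_filter_add_card_filter_not (fun A : Finset ℕ => 2 * n ∈ A), two_mul (N n)]
  have hN : ((((Finset.Icc 1 (2 * n)).powersetCard n).filter fun A => n ∣ ∑ a ∈ A, a).filter
      fun A => ¬ 2 * n ∈ A) =
      ((Finset.Icc 1 (2 * n - 1)).powersetCard n).filter fun A => n ∣ ∑ a ∈ A, a := by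
    ext A
    simp only [Finset.mem_filter, Finset.mem_powersetCard, Finset.subset_iff, Finset.mem_Icc]
    constructor
    · rintro ⟨⟨⟨h1, h2⟩, h3⟩, h4⟩
      refine ⟨⟨fun x hx => ?_, h2⟩, h3⟩
      have := h1 hx
      have : x ≠ 2 * n := fun h => h4 (h ▸ hx)
      omega
    · rintro ⟨⟨h1, h2⟩, h3⟩
      refine ⟨⟨⟨fun x hx => ?_, h2⟩, h3⟩, fun h => ?_⟩
      · have := h1 hx
        omega
      · have := h1 h
        omega
  have hN' := congrArg Finset.card hN
  rw [← N] at hN'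
  rw [hN']
  congr 1
  rw [← hN']
  have htot : ∑ a ∈ Finset.Icc 1 (2 * n), a = n * (2 * n + 1) := by
    have h := Finset.sum_range_id_mul_two (2 * n + 1)
    rw [Finset.range_eq_Ico, Finset.sum_eq_sum_Ico_succ_bot (by omega), zero_add, zero_add,
      show Finset.Ico 1 (2 * n + 1) = Finset.Icc 1 (2 * n) from rfl, Nat.add_sub_cancel] at h
    linarith
  have hcompl : ∀ A : Finset ℕ,
      A ∈ ((Finset.Icc 1 (2 * n)).powersetCard n).filter (fun A => n ∣ ∑ a ∈ A, a) →
      Finset.Icc 1 (2 * n) \ A ∈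
        ((Finset.Icc 1 (2 * n)).powersetCard n).filter (fun A => n ∣ ∑ a ∈ A, a) := fun A hA => by
    simp only [Finset.mem_filter, Finset.mem_powersetCard] at hA ⊢
    obtain ⟨⟨h1, h2⟩, h3⟩ := hA
    refine ⟨⟨Finset.sdiff_subset, ?_⟩, ?_⟩
    · rw [Finset.card_sdiff_of_subset h1, h2, Nat.card_Icc]
      omega
    · rw [← (Nat.dvd_add_left h3), Finset.sum_sdiff h1, htot]
      exact dvd_mul_right _ _
  have hin : ∀ A : Finset ℕ,
      A ∈ ((Finset.Icc 1 (2 * n)).powersetCard n).filter (fun A => n ∣ ∑ a ∈ A, a) →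
      Finset.Icc 1 (2 * n) \ (Finset.Icc 1 (2 * n) \ A) = A := fun A hA => by
    simp only [Finset.mem_filter, Finset.mem_powersetCard] at hA
    rw [Finset.sdiff_sdiff_eq_self hA.1.1]
  have htop : 2 * n ∈ Finset.Icc 1 (2 * n) := Finset.mem_Icc.2 ⟨by omega, le_rfl⟩
  refine Finset.card_nbij' (fun A => Finset.Icc 1 (2 * n) \ A) (fun A => Finset.Icc 1 (2 * n) \ A)
    ?_ ?_ ?_ ?_
  · intro A hA
    rw [Finset.mem_coe, Finset.mem_filter] at hA ⊢
    exact ⟨hcompl A hA.1, by simp [hA.2]⟩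
  · intro A hA
    rw [Finset.mem_coe, Finset.mem_filter] at hA ⊢
    exact ⟨hcompl A hA.1, Finset.mem_sdiff.2 ⟨htop, hA.2⟩⟩
  · intro A hA
    exact hin A (Finset.mem_filter.1 hA).1
  · intro A hA
    exact hin A (Finset.mem_filter.1 hA).1

/-- Ramanujan-type formula for the Erdős–Ginzburg–Ziv numbers. -/
theorem two_mul_mul_N {n : ℕ} (hn : 0 < n) :
    2 * (n : ℤ) * N n =
      ∑ j ∈ Finset.range n, (-1) ^ (n + n.gcd j) * ((2 * n.gcd j).choose (n.gcd j) : ℤ) := by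
  have hζ := Complex.isPrimitiveRoot_exp n hn.ne'
  set ζ := Complex.exp (2 * Real.pi * Complex.I / n)
  have h1 : (2 * n * N n : ℂ) = ∑ j ∈ Finset.range n,
      ∑ A ∈ (Finset.Icc 1 (2 * n)).powersetCard n, (ζ ^ j) ^ ∑ a ∈ A, a := by
    rw [Finset.sum_comm]
    simp only [sum_pow_of_isPrimitiveRoot hζ]
    rw [← Finset.sum_filter, Finset.sum_const, card_powersetCard_dvd_eq_two_mul_N hn, nsmul_eq_mul]
    push_cast
    ring
  have h2 : ∀ j ∈ Finset.range n,
      ∑ A ∈ (Finset.Icc 1 (2 * n)).powersetCard n, (ζ ^ j) ^ ∑ a ∈ A, a =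
        (-1) ^ (n + n.gcd j) * ((2 * n.gcd j).choose (n.gcd j) : ℂ) := fun j _ => by
    have hg : n.gcd j ∣ n := Nat.gcd_dvd_left n j
    have hfin : IsOfFinOrder ζ := isOfFinOrder_iff_pow_eq_one.2 ⟨n, hn, hζ.pow_eq_one⟩
    -- The order of `ζ ^ j` is n / gcd(n, j), so here d g = n with g = gcd(n, j).
    have hord := IsPrimitiveRoot.orderOf (ζ ^ j)
    rw [hfin.orderOf_pow, ← hζ.eq_orderOf] at hord
    have h3 := sum_powersetCard_of_isPrimitiveRoot (g := n.gcd j)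
      (Nat.div_pos (Nat.le_of_dvd hn hg) (Nat.gcd_pos_of_pos_left _ hn)) hord
    rwa [Nat.div_mul_cancel hg] at h3
  rw [Finset.sum_congr rfl h2] at h1
  exact_mod_cast h1

/-! ### Asymptotics of N_n -/

/-- The term j = 0 has gcd n and gives the central binomial. Any other gcd g is a proper divisor, so
2g ≤ n and its term is at most 4^g ≤ 2^n. -/
theorem abs_two_mul_mul_N_sub_le {n : ℕ} (hn : 0 < n) :
    |2 * (n : ℤ) * N n - (n.centralBinom : ℤ)| ≤ n * 2 ^ n := by
  rw [two_mul_mul_N hn]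
  obtain ⟨m, rfl⟩ : ∃ m, n = m + 1 := ⟨n - 1, by omega⟩
  rw [Finset.sum_range_succ', Nat.gcd_zero_right, ← two_mul, pow_mul, neg_one_sq, one_pow, one_mul,
    Nat.centralBinom, add_sub_cancel_right]
  refine (Finset.abs_sum_le_sum_abs _ _).trans ?_
  have hterm : ∀ j ∈ Finset.range m, |(-1 : ℤ) ^ (m + 1 + (m + 1).gcd (j + 1)) *
      (((2 * (m + 1).gcd (j + 1)).choose ((m + 1).gcd (j + 1)) : ℕ) : ℤ)| ≤ 2 ^ (m + 1) := by
    intro j hj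
    rw [abs_mul, abs_neg_one_pow, one_mul, Nat.abs_cast]
    obtain ⟨k, hk⟩ := Nat.gcd_dvd_left (m + 1) (j + 1)
    have hle : (m + 1).gcd (j + 1) ≤ j + 1 := Nat.gcd_le_right _ (by omega)
    set g := (m + 1).gcd (j + 1)
    have hj' := Finset.mem_range.1 hj
    have hk2 : 2 ≤ k := by
      by_contra hk2
      have : k = 0 ∨ k = 1 := by omega
      rcases this with rfl | rfl <;> omega
    have h2g : 2 * g ≤ m + 1 := by rw [hk, mul_comm 2]; exact Nat.mul_le_mul_left _ hk2
    have h1 : (2 * g).choose g ≤ 2 ^ (2 * g) := Nat.choose_le_two_pow _ _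
    exact_mod_cast h1.trans (Nat.pow_le_pow_right (by norm_num) h2g)
  refine (Finset.sum_le_sum hterm).trans ?_
  rw [Finset.sum_const, Finset.card_range, nsmul_eq_mul]
  push_cast
  have : (0 : ℤ) < 2 ^ (m + 1) := by positivity
  nlinarith

theorem abs_N_div_sub_le {n : ℕ} (hn : 0 < n) :
    |(N n : ℝ) / 4 ^ n - (n.centralBinom : ℝ) / 4 ^ n / (2 * n)| ≤ (1 / 2) ^ n / 2 := by
  have hn' : (0 : ℝ) < n := by exact_mod_cast hn
  have h : |2 * (n : ℝ) * N n - (n.centralBinom : ℝ)| ≤ n * 2 ^ n := by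
    exact_mod_cast abs_two_mul_mul_N_sub_le hn
  have h1 : (N n : ℝ) / 4 ^ n - (n.centralBinom : ℝ) / 4 ^ n / (2 * n) =
      (2 * (n : ℝ) * N n - (n.centralBinom : ℝ)) / (2 * n * 4 ^ n) := by
    field_simp
  have h2 : ((1 : ℝ) / 2) ^ n / 2 = n * 2 ^ n / (2 * n * 4 ^ n) := by
    rw [show (4 : ℝ) = 2 * 2 by norm_num, mul_pow, div_pow, one_pow]
    field_simp
  rw [h1, abs_div, h2, abs_of_pos (by positivity : (0 : ℝ) < 2 * n * 4 ^ n)]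
  gcongr

theorem tendsto_sqrt_mul_centralBinom :
    Tendsto (fun n : ℕ => √(n : ℝ) * ((n.centralBinom : ℝ) / 4 ^ n)) atTop (𝓝 (1 / √Real.pi)) := by
  have h1 := Stirling.tendsto_stirlingSeq_sqrt_pi
  have h2 : Tendsto (fun n : ℕ => Stirling.stirlingSeq (2 * n)) atTop (𝓝 √Real.pi) :=
    h1.comp (tendsto_id.const_mul_atTop' (by norm_num))
  have hpi : √Real.pi ≠ 0 := (Real.sqrt_pos.2 Real.pi_pos).ne'
  -- In the quotient of the Stirling sequence at 2n by its square at n the exponential factors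
  -- cancel, leaving √n times the normalised central binomial.
  have h3 := h2.div (h1.pow 2) (pow_ne_zero 2 hpi)
  rw [show √Real.pi / √Real.pi ^ 2 = 1 / √Real.pi by field_simp] at h3
  refine h3.congr' ?_
  filter_upwards [eventually_gt_atTop 0] with n hn
  have hn' : (0 : ℝ) < n := by exact_mod_cast hn
  have hc : (n.centralBinom : ℝ) * (n.factorial * n.factorial) = (2 * n).factorial := by
    have := Nat.choose_mul_factorial_mul_factorial (show n ≤ 2 * n by omega)
    rw [show 2 * n - n = n by omega, mul_assoc] at this
    exact_mod_cast this
  have hf : (n.factorial : ℝ) ≠ 0 := by exact_mod_cast n.factorial_ne_zero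
  have hs : √(n : ℝ) ^ 2 = n := Real.sq_sqrt hn'.le
  have hs0 : √(n : ℝ) ≠ 0 := (Real.sqrt_pos.2 hn').ne'
  simp only [Pi.div_apply, Stirling.stirlingSeq]
  rw [← hc]
  push_cast
  rw [show (2 : ℝ) * (2 * n) = 2 ^ 2 * n by ring, Real.sqrt_mul (by norm_num),
    Real.sqrt_sq (by norm_num), div_pow (n.factorial : ℝ), mul_pow (√(2 * (n : ℝ))),
    Real.sq_sqrt (by positivity), show (2 : ℝ) * n / Real.exp 1 = 2 * (n / Real.exp 1) by ring,
    mul_pow 2, ← pow_mul ((n : ℝ) / Real.exp 1), mul_comm n 2, pow_mul 2]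
  have he : ((n : ℝ) / Real.exp 1) ^ (2 * n) ≠ 0 := by positivity
  generalize ((n : ℝ) / Real.exp 1) ^ (2 * n) = y at he
  rw [show ((2 : ℝ) ^ 2) ^ n = 4 ^ n by norm_num]
  field_simp
  linear_combination (-(n.centralBinom : ℝ)) * hs

theorem tendsto_rpow_mul_N :
    Tendsto (fun n : ℕ => (n : ℝ) ^ (3 / 2 : ℝ) * ((N n : ℝ) / 4 ^ n)) atTop
      (𝓝 (1 / (2 * √Real.pi))) := by
  have h1 : Tendsto (fun n : ℕ => (n : ℝ) ^ (3 / 2 : ℝ) *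
      ((N n : ℝ) / 4 ^ n - (n.centralBinom : ℝ) / 4 ^ n / (2 * n))) atTop (𝓝 0) := by
    have h0 : Tendsto (fun n : ℕ => (n : ℝ) ^ 2 * (1 / 2 : ℝ) ^ n) atTop (𝓝 0) :=
      tendsto_pow_const_mul_const_pow_of_abs_lt_one 2 (by rw [abs_of_pos] <;> norm_num)
    refine squeeze_zero_norm' ?_ h0
    filter_upwards [eventually_gt_atTop 0] with n hn
    have hn' : (1 : ℝ) ≤ n := by exact_mod_cast hn
    rw [norm_mul, Real.norm_eq_abs, Real.norm_eq_abs, abs_of_nonneg (by positivity)]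
    refine mul_le_mul ?_ ((abs_N_div_sub_le hn).trans (half_le_self (by positivity)))
      (abs_nonneg _) (by positivity)
    rw [← Real.rpow_two]
    exact Real.rpow_le_rpow_of_exponent_le hn' (by norm_num)
  have h2 := h1.add (tendsto_sqrt_mul_centralBinom.mul_const (1 / 2))
  rw [zero_add, show 1 / √Real.pi * (1 / 2) = 1 / (2 * √Real.pi) by ring] at h2
  refine h2.congr' ?_
  filter_upwards [eventually_gt_atTop 0] with n hn
  have hn' : (0 : ℝ) < n := by exact_mod_cast hn
  have h3 : (n : ℝ) ^ (3 / 2 : ℝ) = n * √(n : ℝ) := by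
    rw [show (3 / 2 : ℝ) = 1 + 1 / 2 by norm_num, Real.rpow_add hn', Real.rpow_one,
      ← Real.sqrt_eq_rpow]
  rw [h3]
  field_simp
  ring

/-! ### Limits for all and for strong score sequences -/

theorem sum_blocks_eq_N {n : ℕ} (hn : 0 < n) :
    ∑ ij ∈ Finset.HasAntidiagonal.antidiagonal n, ij.1 * Sm ij.1 1 * S ij.2 = N n := by
  simp only [Sm_one_eq_ncard_irreducibles, S_eq_ncard_excursions]
  rw [N_eq_ncard_cyclicPaths hn, ncard_cyclicPaths hn]

theorem tsum_N_div_eq_lam :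
    ∑' n : ℕ, ((∑ ij ∈ Finset.HasAntidiagonal.antidiagonal n,
      ij.1 * Sm ij.1 1 * S ij.2 : ℕ) : ℝ) / 4 ^ n / n = lam := by
  rw [lam, ← (Nat.succ_injective).tsum_eq (f := fun n : ℕ =>
    ((∑ ij ∈ Finset.HasAntidiagonal.antidiagonal n, ij.1 * Sm ij.1 1 * S ij.2 : ℕ) : ℝ) / 4 ^ n / n)]
  · refine tsum_congr fun j => ?_
    rw [sum_blocks_eq_N (Nat.succ_pos j), lamTerm, mul_comm, ← div_div]
  -- The index 0 contributes nothing: the block sum vanishes there. It agrees with N only for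
  -- positive n, since N 0 = 1.
  · intro n hn
    rcases n with - | n
    · simp at hn
    · exact ⟨n, rfl⟩

theorem tendsto_S_and_Sm :
    Tendsto (fun n : ℕ => (n : ℝ) ^ (5 / 2 : ℝ) * (S n / 4 ^ n)) atTop
        (𝓝 (1 / (2 * √Real.pi) * Real.exp lam)) ∧
      Tendsto (fun n : ℕ => (n : ℝ) ^ (5 / 2 : ℝ) * (Sm n 1 / 4 ^ n)) atTop
        (𝓝 (1 / (2 * √Real.pi) * Real.exp (-lam))) := by
  rw [← tsum_N_div_eq_lam]
  refine tendsto_of_blocks (S := S) (I := fun n => Sm n 1) ?_ ?_ (fun n hn => ?_)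
    (fun n => rfl) (tendsto_rpow_mul_N.congr' ?_)
  · simp [Sm_one_eq_ncard_irreducibles, irreducibles]
  · rw [S_eq_ncard_excursions, Set.ncard_eq_one]
    refine ⟨0, Set.eq_singleton_iff_unique_mem.2 ⟨?_, fun P hP => ?_⟩⟩
    · simp [excursions]
    · ext i
      exact hP.2.1 i (Nat.zero_le i)
  · simp only [Sm_one_eq_ncard_irreducibles, S_eq_ncard_excursions]
    exact ncard_excursions hn
  · filter_upwards [eventually_gt_atTop 0] with n hn
    rw [sum_blocks_eq_N hn]

/-! ### Numerical enclosure of λ -/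

/-- `(2n choose n) / 4 ^ n`. -/
noncomputable def centralProb (n : ℕ) : ℝ := (n.centralBinom : ℝ) / 4 ^ n

theorem centralProb_nonneg (n : ℕ) : 0 ≤ centralProb n := by
  unfold centralProb
  positivity

theorem centralProb_succ (n : ℕ) :
    centralProb (n + 1) = centralProb n * ((2 * n + 1) / (2 * n + 2)) := by
  have h : ((n + 1 : ℕ) : ℝ) * (n + 1).centralBinom = 2 * (2 * n + 1) * n.centralBinom := by
    exact_mod_cast Nat.succ_mul_centralBinom_succ n
  unfold centralProb
  push_cast at h
  rw [pow_succ]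
  field_simp
  linear_combination 2 * h

theorem centralProb_le_one (n : ℕ) : centralProb n ≤ 1 := by
  unfold centralProb
  rw [div_le_one (by positivity)]
  have h : n.centralBinom ≤ 2 ^ (2 * n) := Nat.choose_le_two_pow _ _
  rw [pow_mul] at h
  exact_mod_cast h

theorem abs_lamTerm_sub_le (j : ℕ) :
    |lamTerm j - centralProb (j + 1) / (2 * ((j : ℝ) + 1) ^ 2)| ≤
      (1 / 2) ^ (j + 1) / (2 * ((j : ℝ) + 1)) := by
  have h := abs_N_div_sub_le (Nat.succ_pos j)
  have hj : (0 : ℝ) < (j : ℝ) + 1 := by positivity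
  have e : lamTerm j - centralProb (j + 1) / (2 * ((j : ℝ) + 1) ^ 2) =
      ((N (j + 1) : ℝ) / 4 ^ (j + 1) -
        ((j + 1).centralBinom : ℝ) / 4 ^ (j + 1) / (2 * ((j + 1 : ℕ) : ℝ))) / (j + 1) := by
    unfold lamTerm centralProb
    push_cast
    field_simp
  rw [e, abs_div, abs_of_pos hj, show ((1 : ℝ) / 2) ^ (j + 1) / (2 * ((j : ℝ) + 1)) =
    (1 / 2) ^ (j + 1) / 2 / (j + 1) by rw [div_div]]
  gcongr

/-- Telescoping majorant of the tail of `lamTerm`. -/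
noncomputable def tailUpper (m : ℕ) : ℝ :=
  centralProb (m + 11) / (3 * ((m : ℝ) + 10)) + (1 / 2) ^ (m + 11) / 11

/-- Telescoping minorant of the tail of `lamTerm`. -/
noncomputable def tailLower (m : ℕ) : ℝ :=
  centralProb (m + 11) * 2 / (3 * (2 * (m : ℝ) + 21)) - (1 / 2) ^ (m + 11) / 11

theorem error_le (m : ℕ) : ((1 : ℝ) / 2) ^ (m + 11) / (2 * ((m : ℝ) + 11)) ≤
    (1 / 2) ^ (m + 11) / 11 - (1 / 2) ^ (m + 1 + 11) / 11 := by
  have h : ((1 : ℝ) / 2) ^ (m + 1 + 11) = (1 / 2) ^ (m + 11) / 2 := by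
    rw [show m + 1 + 11 = m + 11 + 1 by ring, pow_succ]
    ring
  have hp : (0 : ℝ) < (1 / 2) ^ (m + 11) := by positivity
  rw [h]
  calc ((1 : ℝ) / 2) ^ (m + 11) / (2 * ((m : ℝ) + 11)) ≤ (1 / 2) ^ (m + 11) / (2 * 11) := by
        gcongr
        linarith [(Nat.cast_nonneg m : (0 : ℝ) ≤ m)]
    _ = _ := by ring

/-- With k = m + 11 and b_k the central probability, the main term is b_k/(2k^2). Since b_k decays
like k^(-1/2), its tail is about b_k/(3k); replacing k by k - 1 makes this a telescoping upper
bound, and by k - 1/2 the lower bound of `tailLower`. The geometric part absorbs the error terms. -/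
theorem lamTerm_le_tailUpper_sub (m : ℕ) :
    lamTerm (m + 10) ≤ tailUpper m - tailUpper (m + 1) := by
  have hb := centralProb_nonneg (m + 11)
  have hm : (0 : ℝ) ≤ m := Nat.cast_nonneg m
  have h3 : centralProb (m + 11) / (2 * ((m : ℝ) + 11) ^ 2) ≤
      centralProb (m + 11) / (3 * ((m : ℝ) + 10)) -
        centralProb (m + 1 + 11) / (3 * ((m : ℝ) + 11)) := by
    rw [show m + 1 + 11 = m + 11 + 1 by ring, centralProb_succ (m + 11),
      ← sub_nonneg]
    have e : centralProb (m + 11) / (3 * ((m : ℝ) + 10)) -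
        centralProb (m + 11) * ((2 * ((m + 11 : ℕ) : ℝ) + 1) / (2 * ((m + 11 : ℕ) : ℝ) + 2)) /
          (3 * ((m : ℝ) + 11)) - centralProb (m + 11) / (2 * ((m : ℝ) + 11) ^ 2) =
        centralProb (m + 11) * ((m : ℝ) + 14) /
          (6 * ((m : ℝ) + 11) ^ 2 * ((m : ℝ) + 10) * ((m : ℝ) + 12)) := by
      push_cast
      field_simp
      ring
    rw [e]
    generalize centralProb (m + 11) = c at hb
    positivity
  have h1 := (abs_le.1 (abs_lamTerm_sub_le (m + 10))).2
  have h2 := error_le m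
  rw [show m + 10 + 1 = m + 11 by ring] at h1
  unfold tailUpper
  push_cast at h1 ⊢
  rw [show (m : ℝ) + 10 + 1 = m + 11 by ring] at h1
  rw [show (m : ℝ) + 1 + 10 = m + 11 by ring]
  linarith

theorem tailLower_sub_le_lamTerm (m : ℕ) :
    tailLower m - tailLower (m + 1) ≤ lamTerm (m + 10) := by
  have hb := centralProb_nonneg (m + 11)
  have hm : (0 : ℝ) ≤ m := Nat.cast_nonneg m
  have h3 : centralProb (m + 11) * 2 / (3 * (2 * (m : ℝ) + 21)) -
        centralProb (m + 1 + 11) * 2 / (3 * (2 * (m : ℝ) + 23)) ≤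
      centralProb (m + 11) / (2 * ((m : ℝ) + 11) ^ 2) := by
    rw [show m + 1 + 11 = m + 11 + 1 by ring, centralProb_succ (m + 11),
      ← sub_nonneg]
    have e : centralProb (m + 11) / (2 * ((m : ℝ) + 11) ^ 2) -
        (centralProb (m + 11) * 2 / (3 * (2 * (m : ℝ) + 21)) -
        centralProb (m + 11) * ((2 * ((m + 11 : ℕ) : ℝ) + 1) / (2 * ((m + 11 : ℕ) : ℝ) + 2)) * 2 /
          (3 * (2 * (m : ℝ) + 23))) =
        centralProb (m + 11) * ((m : ℝ) + 10) /
          (2 * ((m : ℝ) + 11) ^ 2 * (2 * (m : ℝ) + 21) * ((m : ℝ) + 12)) := by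
      push_cast
      rw [show 2 * ((m : ℝ) + 11) + 1 = 2 * m + 23 by ring]
      field_simp
      ring
    rw [e]
    generalize centralProb (m + 11) = c at hb
    positivity
  have h1 := (abs_le.1 (abs_lamTerm_sub_le (m + 10))).1
  have h2 := error_le m
  rw [show m + 10 + 1 = m + 11 by ring] at h1
  unfold tailLower
  push_cast at h1 ⊢
  rw [show (m : ℝ) + 10 + 1 = m + 11 by ring] at h1
  rw [show 2 * ((m : ℝ) + 1) + 21 = 2 * m + 23 by ring]
  linarith

theorem lamTerm_nonneg (j : ℕ) : 0 ≤ lamTerm j := by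
  unfold lamTerm
  positivity

theorem tailUpper_nonneg (m : ℕ) : 0 ≤ tailUpper m := by
  have := centralProb_nonneg (m + 11)
  unfold tailUpper
  positivity

theorem sum_tail_le (m : ℕ) : ∑ i ∈ Finset.range m, lamTerm (i + 10) ≤ tailUpper 0 := by
  have h := Finset.sum_le_sum fun i (_ : i ∈ Finset.range m) => lamTerm_le_tailUpper_sub i
  rw [Finset.sum_range_sub'] at h
  linarith [tailUpper_nonneg m]

theorem summable_lamTerm : Summable lamTerm :=
  (summable_nat_add_iff 10).1
    (summable_of_sum_range_le (fun _ => lamTerm_nonneg _) sum_tail_le)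

theorem tendsto_tailLower : Tendsto tailLower atTop (𝓝 0) := by
  have h1 : Tendsto (fun m : ℕ => ((1 : ℝ) / 2) ^ (m + 11) / 11) atTop (𝓝 (0 / 11)) :=
    ((tendsto_add_atTop_iff_nat 11).2
      (tendsto_pow_atTop_nhds_zero_of_lt_one (by norm_num) (by norm_num))).div_const 11
  have h2 : Tendsto (fun m : ℕ => centralProb (m + 11) * 2 / (3 * (2 * (m : ℝ) + 21))) atTop
      (𝓝 0) := by
    refine squeeze_zero (fun m => ?_) (fun m => ?_) tendsto_one_div_add_atTop_nhds_zero_nat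
    · exact div_nonneg (mul_nonneg (centralProb_nonneg _) zero_le_two) (by positivity)
    · have hm : (0 : ℝ) ≤ m := Nat.cast_nonneg m
      rw [div_le_div_iff₀ (by positivity) (by positivity)]
      calc centralProb (m + 11) * 2 * ((m : ℝ) + 1) ≤ 1 * 2 * ((m : ℝ) + 1) := by
            gcongr
            exact centralProb_le_one _
        _ ≤ _ := by linarith
  have h3 := h2.sub h1
  rwa [zero_div, sub_zero] at h3

theorem lam_eq : lam = ∑ i ∈ Finset.range 10, lamTerm i + ∑' i, lamTerm (i + 10) :=
  (summable_lamTerm.sum_add_tsum_nat_add 10).symm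

theorem lam_le : lam ≤ ∑ i ∈ Finset.range 10, lamTerm i + tailUpper 0 := by
  rw [lam_eq]
  gcongr
  exact Real.tsum_le_of_sum_range_le (fun _ => lamTerm_nonneg _) sum_tail_le

theorem le_lam : ∑ i ∈ Finset.range 10, lamTerm i + tailLower 0 ≤ lam := by
  rw [lam_eq]
  gcongr
  have hs := (summable_nat_add_iff 10).2 summable_lamTerm
  have h1 := tendsto_const_nhds (x := tailLower 0) |>.sub tendsto_tailLower
  rw [sub_zero] at h1
  refine le_of_tendsto h1 (Eventually.of_forall fun m => ?_)
  rw [← Finset.sum_range_sub' tailLower m]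
  exact (Finset.sum_le_sum fun i _ => tailLower_sub_le_lamTerm i).trans
    (hs.sum_le_tsum _ fun i _ => lamTerm_nonneg _)

theorem N_values : N 1 = 1 ∧ N 2 = 1 ∧ N 3 = 4 ∧ N 4 = 9 ∧ N 5 = 26 ∧ N 6 = 76 ∧ N 7 = 246 ∧
    N 8 = 809 ∧ N 9 = 2704 ∧ N 10 = 9226 := by
  -- The values are computed from the gcd formula, avoiding an enumeration of subsets.
  have key : ∀ n v : ℕ, 0 < n → 2 * (n : ℤ) * v = ∑ j ∈ Finset.range n,
      (-1) ^ (n + n.gcd j) * ((2 * n.gcd j).choose (n.gcd j) : ℤ) → N n = v := fun n v hn h => by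
    rw [← two_mul_mul_N hn] at h
    have hn' : (2 * n : ℤ) ≠ 0 := by positivity
    exact_mod_cast (mul_left_cancel₀ hn' h).symm
  refine ⟨key _ _ ?_ ?_, key _ _ ?_ ?_, key _ _ ?_ ?_, key _ _ ?_ ?_, key _ _ ?_ ?_, key _ _ ?_ ?_,
    key _ _ ?_ ?_, key _ _ ?_ ?_, key _ _ ?_ ?_, key _ _ ?_ ?_⟩ <;>
  norm_num [Finset.sum_range_succ, Nat.choose]

theorem sum_lamTerm_range : ∑ i ∈ Finset.range 10, lamTerm i =
    1 / 4 + 1 / 32 + 4 / 192 + 9 / 1024 + 26 / 5120 + 76 / 24576 + 246 / 114688 + 809 / 524288 +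
      2704 / 2359296 + 9226 / 10485760 := by
  obtain ⟨h1, h2, h3, h4, h5, h6, h7, h8, h9, h10⟩ := N_values
  simp only [Finset.sum_range_succ, Finset.sum_range_zero, lamTerm, zero_add, Nat.reduceAdd, h1, h2,
    h3, h4, h5, h6, h7, h8, h9, h10]
  norm_num

theorem centralProb_eleven : centralProb 11 = 705432 / 4194304 := by
  norm_num [centralProb, Nat.centralBinom, Nat.choose]

theorem lam_bounds : 0.33 ≤ lam ∧ lam ≤ 0.3305 := by
  have h1 := le_lam
  have h2 := lam_le
  rw [sum_lamTerm_range] at h1 h2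
  rw [tailLower, zero_add, centralProb_eleven] at h1
  rw [tailUpper, zero_add, centralProb_eleven] at h2
  norm_num at h1 h2 ⊢
  constructor <;> linarith

theorem exp_neg_two_mul_lam_bounds :
    0.516 ≤ Real.exp (-2 * lam) ∧ Real.exp (-2 * lam) < 0.517 := by
  obtain ⟨h1, h2⟩ := lam_bounds
  -- The exponents 0.661 and 0.66 are twice the bounds on λ.
  have hu : Real.exp 0.661 ≤ 1 / 0.516 := by
    refine (Real.exp_bound' (by norm_num) (by norm_num) (n := 7) (by norm_num)).trans ?_
    norm_num [Finset.sum_range_succ, Nat.factorial]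
  have hl : 1 / 0.517 < Real.exp 0.66 := by
    refine lt_of_lt_of_le ?_ (Real.sum_le_exp_of_nonneg (by norm_num) 7)
    norm_num [Finset.sum_range_succ, Nat.factorial]
  constructor
  · calc (0.516 : ℝ) ≤ (Real.exp 0.661)⁻¹ := by
          rw [le_inv_comm₀ (by norm_num) (Real.exp_pos _), ← one_div]
          exact hu
      _ = Real.exp (-0.661) := (Real.exp_neg _).symm
      _ ≤ _ := Real.exp_le_exp.2 (by linarith)
  · calc Real.exp (-2 * lam) ≤ Real.exp (-0.66) := Real.exp_le_exp.2 (by linarith)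
      _ = (Real.exp 0.66)⁻¹ := Real.exp_neg _
      _ < 0.517 := by
          rw [inv_lt_comm₀ (Real.exp_pos _) (by norm_num), ← one_div]
          exact hl

/-- The square of this constant is e^(-2λ)/(4π), so the previous enclosure and two decimals of π
suffice. -/
theorem exp_neg_lam_div_bounds :
    0.202 ≤ Real.exp (-lam) / (2 * √Real.pi) ∧ Real.exp (-lam) / (2 * √Real.pi) < 0.203 := by
  obtain ⟨h1, h2⟩ := exp_neg_two_mul_lam_bounds
  have hpi1 := Real.pi_gt_d2
  have hpi2 := Real.pi_lt_d2
  have hsq : (Real.exp (-lam) / (2 * √Real.pi)) ^ 2 = Real.exp (-2 * lam) / (4 * Real.pi) := by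
    rw [div_pow, mul_pow, Real.sq_sqrt Real.pi_pos.le, ← Real.exp_nat_mul]
    norm_num
  have hpos : 0 ≤ Real.exp (-lam) / (2 * √Real.pi) := by positivity
  constructor
  · refine (pow_le_pow_iff_left₀ (by norm_num) hpos two_ne_zero).1 ?_
    rw [hsq, le_div_iff₀ (by positivity)]
    nlinarith
  · refine lt_of_pow_lt_pow_left₀ 2 (by norm_num) ?_
    rw [hsq, div_lt_iff₀ (by positivity)]
    nlinarith

end ScoreSeq

theorem corollary4 :
    Summable ScoreSeq.lamTerm ∧
    Tendsto (fun n : ℕ => (ScoreSeq.Sm n 1 : ℝ) / (ScoreSeq.S n : ℝ)) atTop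
      (𝓝 (Real.exp (-2 * ScoreSeq.lam))) ∧
    (0.516 ≤ Real.exp (-2 * ScoreSeq.lam) ∧ Real.exp (-2 * ScoreSeq.lam) < 0.517) ∧
    Tendsto (fun n : ℕ => (n : ℝ) ^ (5 / 2 : ℝ) * (ScoreSeq.Sm n 1 : ℝ) / 4 ^ n) atTop
      (𝓝 (Real.exp (-ScoreSeq.lam) / (2 * √Real.pi))) ∧
    (0.202 ≤ Real.exp (-ScoreSeq.lam) / (2 * √Real.pi) ∧
      Real.exp (-ScoreSeq.lam) / (2 * √Real.pi) < 0.203) := by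
  obtain ⟨hS, hI⟩ := ScoreSeq.tendsto_S_and_Sm
  have hpi : √Real.pi ≠ 0 := (Real.sqrt_pos.2 Real.pi_pos).ne'
  refine ⟨ScoreSeq.summable_lamTerm, ?_, ScoreSeq.exp_neg_two_mul_lam_bounds, ?_,
    ScoreSeq.exp_neg_lam_div_bounds⟩
  · have h := hI.div hS (by positivity)
    have hlim : 1 / (2 * √Real.pi) * Real.exp (-ScoreSeq.lam) /
        (1 / (2 * √Real.pi) * Real.exp ScoreSeq.lam) = Real.exp (-2 * ScoreSeq.lam) := by
      rw [mul_div_mul_left _ _ (by positivity), ← Real.exp_sub]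
      ring_nf
    rw [hlim] at h
    refine h.congr' ?_
    filter_upwards [eventually_gt_atTop 0] with n hn
    have hn' : (0 : ℝ) < n := by exact_mod_cast hn
    simp only [Pi.div_apply]
    rw [mul_div_mul_left _ _ (by positivity), div_div_div_cancel_right₀ (by positivity)]
  · rw [one_div_mul_eq_div] at hI
    simpa only [mul_div_assoc] using hI
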